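/- Let $\mathcal X=\{0,1\}^N$, let $\mathcal U=\{u\in\mathbb R^N:|\langle u,x\rangle|\le 1\ \forall x\in\mathcal X\}$, and let $\Phi^k_{\mathrm{poly}}$ be the set of all maps $\phi:\mathcal X\to\mathcal X$ each of whose $N$ coordinates is the restriction to $\mathcal X$ of a real polynomial of degree at most $k$. In round $t=1,2,\dots$ a deterministic learner outputs a mixed strategy $\pi^{(t)}\in\Delta(\mathcal X)$, explicitly, as a finite list of points of $\mathcal X$ with nonnegative weights of sum $1$; then a utility vector $u^{(t)}\in\mathcal U$, which may depend on $\pi^{(1)},\dots,\pi^{(t)}$, is revealed to the learner. The average regret after $T$ rounds is $$\overline{\mathrm{Reg}}^T_{\Phi^k_{\mathrm{poly}}}=\frac1T\max_{\phi\in\Phi^k_{\mathrm{poly}}}\sum_{t=1}^T\Big\langle u^{(t)},\ \mathbb E_{x\sim\pi^{(t)}}[\phi(x)-x]\Big\rangle .$$ There are a learner, implemented by one program in the real RAM model (unit-cost arithmetic and comparisons of real numbers) that receives $N$, $k$, $\epsilon$ as inputs, and an absolute constant $C$ such that for all integers $N\ge1$, $k\ge1$, every real $0<\epsilon\le2$ and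 all utilities as above: 1. every round, including the output of $\pi^{(t)}$ and the processing of $u^{(t)}$, takes time at most $C\,N^{Ck^3}/\epsilon$; 2. $\overline{\mathrm{Reg}}^T_{\Phi^k_{\mathrm{poly}}}\le\epsilon$ for every $T\ge C\,N^{Ck^3}/\epsilon^2$. -/

import Mathlib

noncomputable section

namespace LowDegreeRegret

/-! ## The hypercube, utilities, deviations and regret -/

/-- The pure strategies: the points of `{0,1}^N`. -/
abbrev Cube (N : ℕ) : Type := Fin N → Bool

/-- A point of `{0,1}^N` as a vector of `ℝ^N`. -/
def Cube.vec {N : ℕ} (x : Cube N) : Fin N → ℝ := fun i => if x i then 1 else 0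

/-- The utility vectors `u` with `|⟨u, x⟩| ≤ 1` for all `x ∈ {0,1}^N`. -/
def utilities (N : ℕ) : Set (Fin N → ℝ) :=
  {u | ∀ x : Cube N, |∑ i, u i * x.vec i| ≤ 1}

/-- The maps `φ : {0,1}^N → {0,1}^N` each of whose coordinates is the restriction to `{0,1}^N`
of a real polynomial in `N` variables of total degree at most `k`. -/
def polyDeviations (N k : ℕ) : Set (Cube N → Cube N) :=
  {φ | ∀ i, ∃ p : MvPolynomial (Fin N) ℝ, p.totalDegree ≤ k ∧
    ∀ x : Cube N, MvPolynomial.eval x.vec p = (φ x).vec i}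

/-- `⟨u, E_{x ∼ π}[φ(x) - x]⟩`, for a distribution `π` on `{0,1}^N` given by its weights. -/
def deviationGain {N : ℕ} (u : Fin N → ℝ) (π : Cube N → ℝ) (φ : Cube N → Cube N) : ℝ :=
  ∑ i, u i * ∑ x : Cube N, π x * ((φ x).vec i - x.vec i)

/-- The time-average `Φ`-regret after `T` rounds. (The set `Φ` is finite, so that the supremum is
a maximum as soon as `Φ` is nonempty.) -/
def avgRegret {N : ℕ} (Φ : Set (Cube N → Cube N)) (u : ℕ → Fin N → ℝ) (π : ℕ → Cube N → ℝ)
    (T : ℕ) : ℝ :=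
  (1 / (T : ℝ)) * ⨆ φ : Φ, ∑ t ∈ Finset.range T, deviationGain (u t) (π t) φ

/-! ## The real RAM

Programs are structured programs over arrays of natural numbers (used as counters, bits and
addresses) and arrays of real numbers, with indirect addressing. Natural numbers can be added,
subtracted (truncated) and compared; real numbers can be added, subtracted, multiplied, divided
(`x / 0 = 0`) and compared. There is no rounding of reals to natural numbers, and the only
constants are rational. Every operation, memory access and test costs one step. -/

/-- The memory: array `a` has cells `nat a 0, nat a 1, …`, respectively `real a 0, real a 1, …`. -/
@[ext] structure Memory where
  nat : ℕ → ℕ → ℕ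
  real : ℕ → ℕ → ℝ

/-- Expressions with natural number values. -/
inductive NatExp : Type
  | const (n : ℕ)
  | get (a : ℕ) (i : NatExp)
  | add (e f : NatExp)
  | sub (e f : NatExp)

/-- Expressions with real values. -/
inductive RealExp : Type
  | const (q : ℚ)
  | get (a : ℕ) (i : NatExp)
  | add (e f : RealExp)
  | sub (e f : RealExp)
  | mul (e f : RealExp)
  | div (e f : RealExp)

/-- Tests. -/
inductive Test : Type
  | natLt (e f : NatExp)
  | realLt (e f : RealExp)
  | neg (b : Test)
  | both (b c : Test)

namespace NatExp

def eval (σ : Memory) : NatExp → ℕ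
  | const n => n
  | get a i => σ.nat a (i.eval σ)
  | add e f => e.eval σ + f.eval σ
  | sub e f => e.eval σ - f.eval σ

def cost : NatExp → ℕ
  | const _ => 1
  | get _ i => i.cost + 1
  | add e f => e.cost + f.cost + 1
  | sub e f => e.cost + f.cost + 1

end NatExp

namespace RealExp

def eval (σ : Memory) : RealExp → ℝ
  | const q => (q : ℝ)
  | get a i => σ.real a (i.eval σ)
  | add e f => e.eval σ + f.eval σ
  | sub e f => e.eval σ - f.eval σ
  | mul e f => e.eval σ * f.eval σ
  | div e f => e.eval σ / f.eval σ

def cost : RealExp → ℕ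
  | const _ => 1
  | get _ i => i.cost + 1
  | add e f => e.cost + f.cost + 1
  | sub e f => e.cost + f.cost + 1
  | mul e f => e.cost + f.cost + 1
  | div e f => e.cost + f.cost + 1

end RealExp

namespace Test

def holds (σ : Memory) : Test → Prop
  | natLt e f => e.eval σ < f.eval σ
  | realLt e f => e.eval σ < f.eval σ
  | neg b => ¬ b.holds σ
  | both b c => b.holds σ ∧ c.holds σ

def cost : Test → ℕ
  | natLt e f => e.cost + f.cost + 1
  | realLt e f => e.cost + f.cost + 1
  | neg b => b.cost + 1
  | both b c => b.cost + c.cost + 1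

end Test

/-- Programs. -/
inductive Program : Type
  | nop
  | setNat (a : ℕ) (i : NatExp) (e : NatExp)
  | setReal (a : ℕ) (i : NatExp) (e : RealExp)
  | seq (p q : Program)
  | cond (b : Test) (p q : Program)
  | loop (b : Test) (p : Program)

namespace Memory

/-- Overwrite cell `i` of the natural number array `a` by `v`. -/
def putNat (σ : Memory) (a i v : ℕ) : Memory :=
  { σ with nat := Function.update σ.nat a (Function.update (σ.nat a) i v) }

/-- Overwrite cell `i` of the real array `a` by `v`. -/
def putReal (σ : Memory) (a i : ℕ) (v : ℝ) : Memory :=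
  { σ with real := Function.update σ.real a (Function.update (σ.real a) i v) }

end Memory

/-- `Exec p σ n τ`: the program `p`, started with memory `σ`, halts after `n` steps with
memory `τ`. -/
inductive Exec : Program → Memory → ℕ → Memory → Prop
  | nop (σ : Memory) : Exec .nop σ 1 σ
  | setNat (σ : Memory) (a : ℕ) (i e : NatExp) :
      Exec (.setNat a i e) σ (i.cost + e.cost + 1) (σ.putNat a (i.eval σ) (e.eval σ))
  | setReal (σ : Memory) (a : ℕ) (i : NatExp) (e : RealExp) :
      Exec (.setReal a i e) σ (i.cost + e.cost + 1) (σ.putReal a (i.eval σ) (e.eval σ))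
  | seq {p q : Program} {σ τ ρ : Memory} {m n : ℕ} :
      Exec p σ m τ → Exec q τ n ρ → Exec (.seq p q) σ (m + n) ρ
  | condTrue {b : Test} {p q : Program} {σ τ : Memory} {n : ℕ} :
      b.holds σ → Exec p σ n τ → Exec (.cond b p q) σ (b.cost + n + 1) τ
  | condFalse {b : Test} {p q : Program} {σ τ : Memory} {n : ℕ} :
      ¬ b.holds σ → Exec q σ n τ → Exec (.cond b p q) σ (b.cost + n + 1) τ
  | loopStop {b : Test} {p : Program} {σ : Memory} :
      ¬ b.holds σ → Exec (.loop b p) σ (b.cost + 1) σ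
  | loopStep {b : Test} {p : Program} {σ τ ρ : Memory} {m n : ℕ} :
      b.holds σ → Exec p σ m τ → Exec (.loop b p) τ n ρ →
        Exec (.loop b p) σ (b.cost + 1 + m + n) ρ

/-- Programs are deterministic: the final memory and the number of steps are determined by the
program and the initial memory. -/
theorem Exec.deterministic {p : Program} {σ τ τ' : Memory} {n n' : ℕ}
    (h : Exec p σ n τ) (h' : Exec p σ n' τ') : n = n' ∧ τ = τ' := by
  induction h generalizing n' τ' with
  | nop => cases h'; exact ⟨rfl, rfl⟩
  | setNat => cases h'; exact ⟨rfl, rfl⟩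
  | setReal => cases h'; exact ⟨rfl, rfl⟩
  | seq _ _ ih1 ih2 =>
    cases h' with
    | seq h1 h2 =>
      obtain ⟨rfl, rfl⟩ := ih1 h1
      obtain ⟨rfl, rfl⟩ := ih2 h2
      exact ⟨rfl, rfl⟩
  | condTrue hb _ ih =>
    cases h' with
    | condTrue _ h1 => obtain ⟨rfl, rfl⟩ := ih h1; exact ⟨rfl, rfl⟩
    | condFalse hb' _ => exact absurd hb hb'
  | condFalse hb _ ih =>
    cases h' with
    | condTrue hb' _ => exact absurd hb' hb
    | condFalse _ h1 => obtain ⟨rfl, rfl⟩ := ih h1; exact ⟨rfl, rfl⟩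
  | loopStop hb =>
    cases h' with
    | loopStop _ => exact ⟨rfl, rfl⟩
    | loopStep hb' _ _ => exact absurd hb' hb
  | loopStep hb _ _ ih1 ih2 =>
    cases h' with
    | loopStop hb' => exact absurd hb hb'
    | loopStep _ h1 h2 =>
      obtain ⟨rfl, rfl⟩ := ih1 h1
      obtain ⟨rfl, rfl⟩ := ih2 h2
      exact ⟨rfl, rfl⟩

/-! ## Learners -/

/-- A learner consists of two programs that share one memory, which persists across the rounds:
`next` writes the mixed strategy of the current round into the memory, and `observe` is run after
the utility vector of the round has been revealed. -/
structure Learner where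
  next : Program
  observe : Program

/-- The memory before the first round: the inputs are `N`, `k` and `ε`, and all other cells
are `0`. -/
def startMemory (N k : ℕ) (ε : ℝ) : Memory where
  nat a i := if a = 0 ∧ i = 0 then N else if a = 0 ∧ i = 1 then k else 0
  real a i := if a = 0 ∧ i = 0 then ε else 0

/-- The utility vector is written into the first `N` cells of the real array `1`. -/
def Memory.receive {N : ℕ} (σ : Memory) (u : Fin N → ℝ) : Memory where
  nat := σ.nat
  real a i := if h : a = 1 ∧ i < N then u ⟨i, h.2⟩ else σ.real a i

/-- The number of pure strategies that are listed in the output. -/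
def Memory.outLength (σ : Memory) : ℕ := σ.nat 1 0

/-- Coordinate `i` of the `l`-th pure strategy that is listed in the output, as a number. -/
def Memory.outBit (σ : Memory) (N l i : ℕ) : ℕ := σ.nat 2 (l * N + i)

/-- The weight of the `l`-th pure strategy that is listed in the output. -/
def Memory.outWeight (σ : Memory) (l : ℕ) : ℝ := σ.real 2 l

/-- The memory holds the distribution `π` on `{0,1}^N`, as a list of pure strategies together with
nonnegative weights of sum `1`. -/
def Outputs {N : ℕ} (σ : Memory) (π : Cube N → ℝ) : Prop :=
  π ∈ stdSimplex ℝ (Cube N) ∧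
  (∀ l < σ.outLength, 0 ≤ σ.outWeight l ∧ ∀ i : Fin N, σ.outBit N l i ≤ 1) ∧
  (∀ x : Cube N, π x = ∑ l ∈ (Finset.range σ.outLength).filter
    (fun l => x = fun i : Fin N => decide (σ.outBit N l i = 1)), σ.outWeight l)

/-- Run on the parameters `N`, `k`, `ε` against the utilities `u 0, u 1, …`, the learner plays the
mixed strategies `π 0, π 1, …`, and round `t` takes time `time t`: the steps of the two programs,
the number `(N + 1) * outLength` of cells of the output, and the number `N` of cells of the
revealed utility vector. By determinism `π t` depends on `u 0, …, u (t - 1)` only; so a statement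
about all sequences `u` covers adversaries that choose `u t` with knowledge of `π 0, …, π t`. -/
def Plays (A : Learner) (N k : ℕ) (ε : ℝ) (u : ℕ → Fin N → ℝ) (π : ℕ → Cube N → ℝ)
    (time : ℕ → ℕ) : Prop :=
  ∃ (σ τ : ℕ → Memory) (m n : ℕ → ℕ), σ 0 = startMemory N k ε ∧
    ∀ t, Exec A.next (σ t) (m t) (τ t) ∧ Outputs (τ t) (π t) ∧
      Exec A.observe ((τ t).receive (u t)) (n t) (σ (t + 1)) ∧
      time t = m t + (N + 1) * (τ t).outLength + N + n t

end LowDegreeRegret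

end

noncomputable section

namespace LowDegreeRegret

open Finset

/-! Each coordinate of a deviation is a Boolean function of degree at most `k`, and such a function
has a decision tree of depth at most `k ^ 3`. It therefore suffices to have small regret against
trees, and a tree is a sum of labelled conjunctions of few literals, of which there are only
polynomially many for fixed `k`.

The depth bound has two ingredients. If each of `n` disjoint sensitive blocks is flipped
independently with probability `X`, the expected value of the function is a polynomial of degree at
most `k` that maps the unit interval to itself and whose derivative at `0` is `± n`; Markov's
inequality gives `n ≤ k ^ 2` (`HasSensitiveBlocks.le_sq`). Moreover, some set of at most `k`
coordinates meets the variation of the function at every point, so that querying it lowers the block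
sensitivity by one (`hasSensitiveBlocks_succ`). After at most `k ^ 2` such batches of queries the
function is constant.

The learner keeps, for each coordinate, conjunction and label, a specialist that is awake where the
conjunction holds. A prediction in `[0, 1]` is formed from the weights so that the weighted gains
cancel at every point, whatever the utility turns out to be (`awakeWeight_mul_add`). As in Blackwell
approachability, the squared norm of the weights then grows at most linearly in time, so each
specialist has regret of order `√T`. A tree of depth `d` has at most `2 ^ d` leaves, each charged to
one specialist (`HasTree.regret_le`).

No fixed point of the prediction map is computed. The learner plays a short list of points, each
obtained by rounding the accumulated difference between earlier predictions and earlier points. That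
difference stays bounded, so over `L` points the average prediction and the average point differ by
at most `2 / L` in each coordinate. Taking `L` of order `1 / ε` makes this error negligible.

The rest is a simulation proof: an explicit program realises the abstract learner, with a bound of
order `L * W ^ 2` on its steps, `W` being the number of conjunctions. -/

/-! ## Functions of low degree on the cube -/

section Degree

variable {N : ℕ}

/-- The real functions on the cube of degree at most `k`. -/
def degreeLE (N k : ℕ) : Submodule ℝ (Cube N → ℝ) :=
  Submodule.span ℝ {g | ∃ (A : Finset (Fin N)) (h : Fin N → Bool → ℝ),
    A.card ≤ k ∧ g = fun x => ∏ v ∈ A, h v (x v)}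

theorem eval_mem_degreeLE {k : ℕ} (p : MvPolynomial (Fin N) ℝ) (hp : p.totalDegree ≤ k) :
    (fun x : Cube N => MvPolynomial.eval x.vec p) ∈ degreeLE N k := by
  have : (fun x : Cube N => MvPolynomial.eval x.vec p) =
      ∑ m ∈ p.support, p.coeff m • fun x : Cube N => ∏ v ∈ m.support, x.vec v ^ m v := by
    funext x
    simp [MvPolynomial.eval_eq]
  rw [this]
  refine Submodule.sum_mem _ fun m hm => Submodule.smul_mem _ _ (Submodule.subset_span
    ⟨m.support, fun v b => (if b then 1 else 0) ^ m v, ?_, rfl⟩)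
  refine le_trans ?_ ((MvPolynomial.le_totalDegree hm).trans hp)
  rw [Finset.card_eq_sum_ones]
  exact Finset.sum_le_sum fun v hv => Nat.one_le_iff_ne_zero.mpr (Finsupp.mem_support_iff.mp hv)

/-- Expand in the indicators of points. This allows `k` to be replaced by `min k N`, without which
the number of conjunctions could not be bounded at `N = 1`, where every power of `N` is `1`. -/
theorem mem_degreeLE_card (f : Cube N → ℝ) : f ∈ degreeLE N N := by
  have : f = ∑ z : Cube N, f z • fun x : Cube N => ∏ v, (if x v = z v then (1 : ℝ) else 0) := by
    funext x
    simp only [Finset.sum_apply, Pi.smul_apply, smul_eq_mul]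
    rw [Finset.sum_eq_single x]
    · simp
    · intro z _ hz
      obtain ⟨v, hv⟩ := Function.ne_iff.mp hz.symm
      rw [Finset.prod_eq_zero (Finset.mem_univ v) (if_neg hv), mul_zero]
    · simp
  rw [this]
  exact Submodule.sum_mem _ fun z _ => Submodule.smul_mem _ _ (Submodule.subset_span
    ⟨Finset.univ, fun v b => if b = z v then 1 else 0, by simp, rfl⟩)

/-- Substituting constants for some coordinates does not raise the degree. -/
theorem comp_piecewise_mem_degreeLE {k : ℕ} {f : Cube N → ℝ} (hf : f ∈ degreeLE N k)
    (M : Finset (Fin N)) (ρ : Cube N) :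
    (fun x => f (M.piecewise ρ x)) ∈ degreeLE N k := by
  let Λ : (Cube N → ℝ) →ₗ[ℝ] (Cube N → ℝ) := LinearMap.funLeft ℝ ℝ fun x => M.piecewise ρ x
  change Λ f ∈ degreeLE N k
  refine (Submodule.map_span_le Λ _ (degreeLE N k)).mpr ?_ (Submodule.mem_map_of_mem hf)
  rintro _ ⟨A, h, hA, rfl⟩
  refine Submodule.subset_span
    ⟨A, fun v b => if v ∈ M then h v (ρ v) else h v b, hA, ?_⟩
  funext x
  refine Finset.prod_congr rfl fun v _ => ?_
  by_cases hv : v ∈ M <;> simp [hv]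

/-- The discrete derivative in the direction of a coordinate. -/
def discreteDeriv (v : Fin N) : (Cube N → ℝ) →ₗ[ℝ] (Cube N → ℝ) :=
  LinearMap.funLeft ℝ ℝ (fun x => Function.update x v true) -
    LinearMap.funLeft ℝ ℝ (fun x => Function.update x v false)

theorem discreteDeriv_apply (v : Fin N) (f : Cube N → ℝ) (x : Cube N) :
    discreteDeriv v f x = f (Function.update x v true) - f (Function.update x v false) := rfl

theorem discreteDeriv_prod_of_notMem {v : Fin N} {A : Finset (Fin N)} (hv : v ∉ A)
    (h : Fin N → Bool → ℝ) : discreteDeriv v (fun x => ∏ w ∈ A, h w (x w)) = 0 := by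
  funext x
  rw [discreteDeriv_apply, Pi.zero_apply, sub_eq_zero]
  refine Finset.prod_congr rfl fun w hw => ?_
  have : w ≠ v := fun e => hv (e ▸ hw)
  simp [this]

theorem discreteDeriv_prod_of_mem {v : Fin N} {A : Finset (Fin N)} (hv : v ∈ A)
    (h : Fin N → Bool → ℝ) : discreteDeriv v (fun x => ∏ w ∈ A, h w (x w)) =
      (h v true - h v false) • fun x => ∏ w ∈ A.erase v, h w (x w) := by
  funext x
  have key : ∀ b, ∏ w ∈ A, h w (Function.update x v b w) =
      h v b * ∏ w ∈ A.erase v, h w (x w) := by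
    intro b
    rw [← Finset.mul_prod_erase A _ hv, Function.update_self]
    congr 1
    refine Finset.prod_congr rfl fun w hw => ?_
    rw [Function.update_of_ne (Finset.ne_of_mem_erase hw)]
  rw [discreteDeriv_apply, key, key, Pi.smul_apply, smul_eq_mul]
  ring

theorem discreteDeriv_mem_degreeLE {k : ℕ} {f : Cube N → ℝ} (hf : f ∈ degreeLE N (k + 1))
    (v : Fin N) : discreteDeriv v f ∈ degreeLE N k := by
  refine (Submodule.map_span_le (discreteDeriv v) _ (degreeLE N k)).mpr ?_
    (Submodule.mem_map_of_mem hf)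
  rintro _ ⟨A, h, hA, rfl⟩
  by_cases hv : v ∈ A
  · rw [discreteDeriv_prod_of_mem hv]
    refine Submodule.smul_mem _ _ (Submodule.subset_span ⟨A.erase v, h, ?_, rfl⟩)
    rw [Finset.card_erase_of_mem hv]
    omega
  · rw [discreteDeriv_prod_of_notMem hv]
    exact Submodule.zero_mem _

theorem discreteDeriv_eq_zero_of_mem_degreeLE_zero {f : Cube N → ℝ} (hf : f ∈ degreeLE N 0)
    (v : Fin N) : discreteDeriv v f = 0 := by
  have : discreteDeriv v f ∈ (⊥ : Submodule ℝ (Cube N → ℝ)) := by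
    refine (Submodule.map_span_le (discreteDeriv v) _ ⊥).mpr ?_ (Submodule.mem_map_of_mem hf)
    rintro _ ⟨A, h, hA, rfl⟩
    rw [Finset.card_eq_zero.mp (Nat.le_zero.mp hA)]
    exact discreteDeriv_prod_of_notMem (Finset.notMem_empty v) h
  simpa using this

/-- Overwriting one coordinate never changes the value, and `x` becomes `y` by overwriting the
coordinates one at a time. -/
theorem eq_of_discreteDeriv_eq_zero {f : Cube N → ℝ} (hf : ∀ v, discreteDeriv v f = 0)
    (x y : Cube N) : f x = f y := by
  have hupd : ∀ x v b, f (Function.update x v b) = f x := by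
    intro x v b
    have h := congrFun (hf v) x
    rw [discreteDeriv_apply, Pi.zero_apply, sub_eq_zero] at h
    have : ∀ b, f (Function.update x v b) = f (Function.update x v true) := by
      rintro (_ | _)
      · exact h.symm
      · rfl
    rw [this b, ← this (x v), Function.update_eq_self]
  have : ∀ S : Finset (Fin N), f (S.piecewise y x) = f x := by
    intro S
    induction S using Finset.induction_on with
    | empty => simp
    | insert v S hv ih => rw [Finset.piecewise_insert, hupd, ih]
  have h := this Finset.univ
  rw [Finset.piecewise_univ] at h
  exact h.symm

/-- A nonconstant function of degree at most `k` has a set of at most `k` coordinates such that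
no assignment of the other coordinates makes it constant. -/
theorem exists_card_le_forall_exists_ne {k : ℕ} {f : Cube N → ℝ} (hf : f ∈ degreeLE N k)
    (hne : ¬ ∀ x y, f x = f y) :
    ∃ M : Finset (Fin N), M.card ≤ k ∧ ∀ z, ∃ y, (∀ v ∉ M, y v = z v) ∧ f y ≠ f z := by
  induction k generalizing f with
  | zero =>
    exact absurd (eq_of_discreteDeriv_eq_zero fun v =>
      discreteDeriv_eq_zero_of_mem_degreeLE_zero hf v) hne
  | succ k ih =>
    obtain ⟨v, hv⟩ : ∃ v, discreteDeriv v f ≠ 0 := by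
      by_contra! h
      exact hne (eq_of_discreteDeriv_eq_zero h)
    by_cases hc : ∀ x y, discreteDeriv v f x = discreteDeriv v f y
    -- A constant derivative is nonzero everywhere, so the coordinate `v` alone changes `f` at every
    -- point.
    · refine ⟨{v}, by simp, fun z => ?_⟩
      have hz : discreteDeriv v f z ≠ 0 := by
        intro h0
        exact hv (funext fun x => (hc x z).trans h0)
      by_contra! hall
      refine hz ?_
      have hup : ∀ b, f (Function.update z v b) = f z := fun b => hall _ fun w hw => by
        rw [Function.update_of_ne (by simpa using hw)]
      rw [discreteDeriv_apply, hup, hup, sub_self]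
    -- The derivative varies on every fibre of `M`. It is a difference of two values of `f`, so `f`
    -- cannot be constant on a fibre of `insert v M`.
    · obtain ⟨M, hM, h⟩ := ih (discreteDeriv_mem_degreeLE hf v) hc
      refine ⟨insert v M, (Finset.card_insert_le _ _).trans (by omega), fun z => ?_⟩
      obtain ⟨y, hy, hne⟩ := h z
      by_contra! hall
      refine hne ?_
      have hup : ∀ w ∉ insert v M, ∀ b, Function.update y v b w = z w := by
        intro w hw b
        rw [Finset.mem_insert, not_or] at hw
        rw [Function.update_of_ne hw.1, hy w hw.2]
      have hup' : ∀ w ∉ insert v M, ∀ b, Function.update z v b w = z w := by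
        intro w hw b
        rw [Finset.mem_insert, not_or] at hw
        rw [Function.update_of_ne hw.1]
      rw [discreteDeriv_apply, discreteDeriv_apply, hall _ fun w hw => hup w hw _,
        hall _ fun w hw => hup w hw _, hall _ fun w hw => hup' w hw _,
        hall _ fun w hw => hup' w hw _]

end Degree

/-! ## Block sensitivity -/

section Sensitivity

variable {N : ℕ}

/-- Flip the coordinates of `z` whose label belongs to `T`. -/
def flipBlocks (z : Cube N) (β : Fin N → ℕ) (T : Finset ℕ) : Cube N :=
  fun v => if β v ∈ T then !z v else z v

/-- `f` has `n` disjoint sensitive blocks at some point: the blocks with the labels `0, …, n - 1`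
of a labelling of the coordinates. -/
def HasSensitiveBlocks (f : Cube N → ℝ) (n : ℕ) : Prop :=
  ∃ (z : Cube N) (β : Fin N → ℕ), ∀ i < n, f (flipBlocks z β {i}) ≠ f z

open Polynomial

/-- The expectation of `f` if each of `n` blocks of `z` is flipped with probability `X`. -/
def flipPoly (z : Cube N) (β : Fin N → ℕ) (n : ℕ) (f : Cube N → ℝ) : ℝ[X] :=
  ∑ T ∈ (Finset.range n).powerset,
    X ^ T.card * (1 - X) ^ (n - T.card) * C (f (flipBlocks z β T))

/-- The blocks are flipped independently, so the expectation of a product factors over the blocks;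
coordinates outside the `n` blocks are never flipped. -/
theorem flipPoly_prod (z : Cube N) (β : Fin N → ℕ) (n : ℕ) (A : Finset (Fin N))
    (h : Fin N → Bool → ℝ) :
    flipPoly z β n (fun x => ∏ v ∈ A, h v (x v)) =
      C (∏ v ∈ A with β v ∉ Finset.range n, h v (z v)) *
        ∏ i ∈ Finset.range n, (X * C (∏ v ∈ A with β v = i, h v (!z v)) +
          (1 - X) * C (∏ v ∈ A with β v = i, h v (z v))) := by
  rw [Finset.prod_add, Finset.mul_sum, flipPoly]
  refine Finset.sum_congr rfl fun T hT => ?_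
  rw [Finset.mem_powerset] at hT
  rw [Finset.prod_mul_distrib, Finset.prod_mul_distrib, Finset.prod_const, Finset.prod_const,
    Finset.card_sdiff_of_subset hT, Finset.card_range, ← map_prod, ← map_prod]
  have key : ∏ v ∈ A, h v (flipBlocks z β T v) =
      (∏ v ∈ A with β v ∉ Finset.range n, h v (z v)) *
        ((∏ i ∈ T, ∏ v ∈ A with β v = i, h v (!z v)) *
          ∏ i ∈ Finset.range n \ T, ∏ v ∈ A with β v = i, h v (z v)) := by
    rw [← Finset.prod_filter_not_mul_prod_filter A (fun v => β v ∈ Finset.range n)]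
    congr 1
    · refine Finset.prod_congr rfl fun v hv => ?_
      have : β v ∉ T := fun hb => (Finset.mem_filter.mp hv).2 (hT hb)
      simp [flipBlocks, this]
    · rw [← Finset.prod_fiberwise_of_maps_to (s := {v ∈ A | β v ∈ Finset.range n})
        (t := Finset.range n) (g := β) (fun v hv => (Finset.mem_filter.mp hv).2),
        ← Finset.prod_sdiff hT, mul_comm]
      congr 1
      · refine Finset.prod_congr rfl fun i hi => ?_
        rw [Finset.filter_filter]
        refine Finset.prod_congr ?_ ?_
        · ext v
          simp only [Finset.mem_filter]
          refine and_congr_right fun _ => ⟨fun h => h.2, fun h => ⟨?_, h⟩⟩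
          rw [h]; exact hT hi
        · intro v hv
          simp [flipBlocks, (Finset.mem_filter.mp hv).2, hi]
      · refine Finset.prod_congr rfl fun i hi => ?_
        rw [Finset.filter_filter]
        refine Finset.prod_congr ?_ ?_
        · ext v
          simp only [Finset.mem_filter]
          refine and_congr_right fun _ => ⟨fun h => h.2, fun h => ⟨?_, h⟩⟩
          rw [h]; exact (Finset.mem_sdiff.mp hi).1
        · intro v hv
          simp [flipBlocks, (Finset.mem_filter.mp hv).2, (Finset.mem_sdiff.mp hi).2]
  rw [key]
  simp only [map_mul]
  ring

/-- A block that misses `A` contributes the factor `X + (1 - X) = 1`, any other block a factor of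
degree at most one, and at most `A.card` disjoint blocks meet `A`. -/
theorem natDegree_flipPoly_prod_le (z : Cube N) (β : Fin N → ℕ) (n : ℕ) (A : Finset (Fin N))
    (h : Fin N → Bool → ℝ) :
    (flipPoly z β n (fun x => ∏ v ∈ A, h v (x v))).natDegree ≤ A.card := by
  rw [flipPoly_prod]
  refine (natDegree_C_mul_le _ _).trans ((natDegree_prod_le _ _).trans ?_)
  have hcard : ∑ i ∈ Finset.range n, (A.filter (fun v => β v = i)).card ≤ A.card := by
    rw [← Finset.card_biUnion]
    · exact Finset.card_le_card (Finset.biUnion_subset.mpr fun i _ => Finset.filter_subset _ _)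
    · intro i _ j _ hij
      exact Finset.disjoint_filter.mpr fun v _ h1 h2 => hij (h1.symm.trans h2)
  refine le_trans (Finset.sum_le_sum fun i _ => ?_) hcard
  by_cases hA : A.filter (fun v => β v = i) = ∅
  · simp [hA]
  · have h1 : 1 ≤ (A.filter (fun v => β v = i)).card :=
      Finset.card_pos.mpr (Finset.nonempty_iff_ne_empty.mpr hA)
    refine le_trans ?_ h1
    have h2 : (1 - X : ℝ[X]).natDegree ≤ 1 := by
      refine (natDegree_sub_le _ _).trans ?_
      simp
    refine (natDegree_add_le _ _).trans (max_le ?_ ?_)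
    · exact (natDegree_mul_C_le _ _).trans natDegree_X_le
    · exact (natDegree_mul_C_le _ _).trans h2

theorem natDegree_flipPoly_le {k : ℕ} {f : Cube N → ℝ} (hf : f ∈ degreeLE N k) (z : Cube N)
    (β : Fin N → ℕ) (n : ℕ) : (flipPoly z β n f).natDegree ≤ k := by
  rw [natDegree_le_iff_degree_le, ← mem_degreeLE]
  let Λ : (Cube N → ℝ) →ₗ[ℝ] ℝ[X] :=
    { toFun := flipPoly z β n
      map_add' := fun f g => by
        simp only [flipPoly, Pi.add_apply, map_add, mul_add, Finset.sum_add_distrib]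
      map_smul' := fun c f => by
        simp only [flipPoly, Pi.smul_apply, smul_eq_mul, map_mul, RingHom.id_apply,
          Finset.smul_sum, smul_eq_C_mul]
        exact Finset.sum_congr rfl fun T _ => by ring }
  change Λ f ∈ Polynomial.degreeLE ℝ k
  refine (Submodule.map_span_le Λ _ (Polynomial.degreeLE ℝ k)).mpr ?_
    (Submodule.mem_map_of_mem hf)
  rintro _ ⟨A, h, hA, rfl⟩
  rw [mem_degreeLE, ← natDegree_le_iff_degree_le]
  exact (natDegree_flipPoly_prod_le z β n A h).trans hA

/-- The value at `t` is a convex combination of values of `f`; the weights have sum one by the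
binomial theorem. -/
theorem eval_flipPoly_mem_Icc {f : Cube N → ℝ} (hf : ∀ x, f x ∈ Set.Icc (0 : ℝ) 1) (z : Cube N)
    (β : Fin N → ℕ) (n : ℕ) {t : ℝ} (ht : t ∈ Set.Icc (0 : ℝ) 1) :
    (flipPoly z β n f).eval t ∈ Set.Icc (0 : ℝ) 1 := by
  have h1 : (0 : ℝ) ≤ 1 - t := sub_nonneg.mpr ht.2
  simp only [flipPoly, eval_finsetSum, eval_mul, eval_pow, eval_X, eval_sub, eval_one, eval_C]
  constructor
  · exact Finset.sum_nonneg fun T _ =>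
      mul_nonneg (mul_nonneg (pow_nonneg ht.1 _) (pow_nonneg h1 _)) (hf _).1
  · have hsum : ∑ T ∈ (Finset.range n).powerset, t ^ T.card * (1 - t) ^ (n - T.card) = 1 := by
      have := Finset.sum_pow_mul_eq_add_pow t (1 - t) (Finset.range n)
      rw [Finset.card_range] at this
      rw [this]
      simp
    refine le_trans (Finset.sum_le_sum fun T _ => mul_le_of_le_one_right
      (mul_nonneg (pow_nonneg ht.1 _) (pow_nonneg h1 _)) (hf _).2) hsum.le

/-- To first order at `0` at most one block is flipped: only the empty set and the singletons
contribute. -/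
theorem eval_derivative_flipPoly (f : Cube N → ℝ) (z : Cube N) (β : Fin N → ℕ) (n : ℕ) :
    (derivative (flipPoly z β n f)).eval 0 =
      ∑ i ∈ Finset.range n, (f (flipBlocks z β {i}) - f z) := by
  have hterm : ∀ T : Finset ℕ, (derivative (X ^ T.card * (1 - X) ^ (n - T.card) *
      C (f (flipBlocks z β T)))).eval 0 = (T.card * 0 ^ (T.card - 1) -
        0 ^ T.card * (n - T.card : ℕ)) * f (flipBlocks z β T) := by
    intro T
    simp [derivative_pow]
    left
    ring
  rw [flipPoly, derivative_sum, eval_finsetSum, Finset.sum_congr rfl fun T _ => hterm T,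
    Finset.sum_powerset, Finset.card_range]
  rcases n with _ | n
  · simp
  · have hz : ∀ j ∈ Finset.range n, ∑ T ∈ Finset.powersetCard (j + 1 + 1) (Finset.range (n + 1)),
        ((T.card : ℝ) * 0 ^ (T.card - 1) - 0 ^ T.card * (n + 1 - T.card : ℕ)) *
          f (flipBlocks z β T) = 0 := by
      intro j _
      refine Finset.sum_eq_zero fun T hT => ?_
      rw [(Finset.mem_powersetCard.mp hT).2]
      simp
    rw [Finset.sum_range_succ', Finset.sum_range_succ', Finset.sum_eq_zero hz]
    have h0 : flipBlocks z β ∅ = z := by funext v; simp [flipBlocks]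
    simp [Finset.powersetCard_one, h0]
    ring

/-- **Markov's inequality** at an endpoint of the unit interval. -/
theorem derivative_eval_zero_le {k : ℕ} {p : ℝ[X]} (hp : p.natDegree ≤ k)
    (h : ∀ t ∈ Set.Icc (0 : ℝ) 1, p.eval t ∈ Set.Icc (0 : ℝ) 1) :
    (derivative p).eval 0 ≤ k ^ 2 := by
  -- The affine changes of variable and value move `[0, 1]` to `[-1, 1]` and the endpoint `0` to
  -- `1`. Their slopes cancel, so that `q' 1 = p' 0`, and Chebyshev extremality bounds `q' 1` by
  -- `T_k' 1 = k ^ 2`.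
  let q : ℝ[X] := 1 - C 2 * p.comp (C (1 / 2) * (1 - X))
  have hlin : (C (1 / 2) * (1 - X) : ℝ[X]).natDegree ≤ 1 := by
    refine (natDegree_C_mul_le _ _).trans ((natDegree_sub_le _ _).trans ?_)
    simp
  have hq : q.degree ≤ k := by
    rw [← natDegree_le_iff_degree_le]
    refine (natDegree_sub_le _ _).trans (max_le (by simp) ?_)
    refine (natDegree_C_mul_le _ _).trans ((natDegree_comp_le).trans ?_)
    exact (Nat.mul_le_mul hp hlin).trans (by simp)
  have hb : ∀ x ∈ Set.Icc (-1 : ℝ) 1, |q.eval x| ≤ 1 := by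
    intro x hx
    have := h (1 / 2 * (1 - x)) ⟨by linarith [hx.2], by linarith [hx.1]⟩
    simp only [q, eval_sub, eval_one, eval_mul, eval_C, eval_comp, eval_X]
    rw [abs_le]
    exact ⟨by linarith [this.2], by linarith [this.1]⟩
  have := Chebyshev.eval_iterate_derivative_le_of_forall_abs_le_one (k := 1) le_rfl hq hb
  rw [Function.iterate_one, Chebyshev.T_derivative_eq_U] at this
  have hq' : (derivative q).eval 1 = (derivative p).eval 0 := by
    simp only [q, derivative_sub, derivative_one, derivative_C_mul, derivative_comp, eval_sub,
      eval_mul, eval_C, eval_comp, eval_X, eval_one, derivative_X]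
    simp
  rw [hq'] at this
  refine this.trans (le_of_eq ?_)
  simp [Chebyshev.U_eval_one]
  ring

/-- The block sensitivity of a Boolean function of degree `k` is at most `k ^ 2`. -/
theorem HasSensitiveBlocks.le_sq {k n : ℕ} {f : Cube N → ℝ} (hf : f ∈ degreeLE N k)
    (h01 : ∀ x, f x = 0 ∨ f x = 1) (h : HasSensitiveBlocks f n) : n ≤ k ^ 2 := by
  obtain ⟨z, β, h⟩ := h
  -- If the value at `z` is `0`, each sensitive block adds exactly `1` to the derivative at `0`. The
  -- value `1` is reduced to this case by passing to `1 - f`.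
  have hpos : ∀ g : Cube N → ℝ, g ∈ degreeLE N k → (∀ x, g x = 0 ∨ g x = 1) → g z = 0 →
      (∀ i < n, g (flipBlocks z β {i}) ≠ g z) → n ≤ k ^ 2 := by
    intro g hg hg01 hz hne
    have hI : ∀ x, g x ∈ Set.Icc (0 : ℝ) 1 := by
      intro x
      rcases hg01 x with h | h <;> rw [h] <;> simp
    have := derivative_eval_zero_le (natDegree_flipPoly_le hg z β n)
      fun t ht => eval_flipPoly_mem_Icc hI z β n ht
    rw [eval_derivative_flipPoly, Finset.sum_congr rfl (g := fun _ => (1 : ℝ))] at this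
    · simp only [Finset.sum_const, Finset.card_range, nsmul_eq_mul, mul_one] at this
      exact_mod_cast this
    · intro i hi
      have h1 := hne i (Finset.mem_range.mp hi)
      rw [hz] at h1 ⊢
      rw [(hg01 _).resolve_left h1, sub_zero]
  rcases h01 z with hz | hz
  · exact hpos f hf h01 hz h
  · refine hpos (fun x => 1 - f x) ?_ ?_ (by simp [hz]) ?_
    · refine Submodule.sub_mem _ (Submodule.subset_span ⟨∅, fun _ _ => 0, by simp, ?_⟩) hf
      funext x; simp
    · intro x
      rcases h01 x with h | h <;> simp [h]
    · intro i hi he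
      exact h i hi (by linarith)

end Sensitivity

/-! ## Decision trees -/

section Trees

variable {N : ℕ}

/-- `f` is computed by a decision tree of depth at most `d`. -/
inductive HasTree : ℕ → (Cube N → ℝ) → Prop
  | zero {d : ℕ} {f : Cube N → ℝ} (h : ∀ x, f x = 0) : HasTree d f
  | one {d : ℕ} {f : Cube N → ℝ} (h : ∀ x, f x = 1) : HasTree d f
  | node {d : ℕ} {f : Cube N → ℝ} (v : Fin N)
      (h : ∀ b, HasTree d fun x => f (Function.update x v b)) : HasTree (d + 1) f

theorem HasTree.mono {d d' : ℕ} {f : Cube N → ℝ} (h : HasTree d f) (hd : d ≤ d') :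
    HasTree d' f := by
  induction h generalizing d' with
  | zero h => exact .zero h
  | one h => exact .one h
  | node v _ ih =>
    obtain ⟨e, rfl⟩ : ∃ e, d' = e + 1 := ⟨d' - 1, by omega⟩
    exact .node v fun b => ih b (by omega)

/-- Query a set of coordinates one after the other. -/
theorem HasTree.of_piecewise {d : ℕ} (M : Finset (Fin N)) {f : Cube N → ℝ}
    (h : ∀ ρ : Cube N, HasTree d fun x => f (M.piecewise ρ x)) : HasTree (M.card + d) f := by
  induction M using Finset.induction_on generalizing f with
  | empty => simpa using h fun _ => false
  | insert v M hv ih =>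
    rw [Finset.card_insert_of_notMem hv, add_right_comm]
    refine .node v fun b => ih fun ρ => ?_
    have := h (Function.update ρ v b)
    simp only [Finset.piecewise_insert, Function.update_self] at this
    convert this using 4 with x
    refine (Finset.piecewise_congr _ (fun w hw => ?_) fun w _ => rfl)
    rw [Function.update_of_ne (ne_of_mem_of_not_mem hw hv)]

/-- After `M` is fixed to `ρ`, coordinates in `M` no longer matter, so the sensitive blocks of the
restriction may be taken outside `M`. The coordinates of `M` that must be flipped to change `f` form
a further block, disjoint from these. -/
theorem hasSensitiveBlocks_succ {n : ℕ} {f : Cube N → ℝ} {M : Finset (Fin N)}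
    (hM : ∀ z, ∃ y, (∀ v ∉ M, y v = z v) ∧ f y ≠ f z) (ρ : Cube N)
    (h : HasSensitiveBlocks (fun x => f (M.piecewise ρ x)) n) : HasSensitiveBlocks f (n + 1) := by
  obtain ⟨z, β, h⟩ := h
  obtain ⟨y, hy, hne⟩ := hM (M.piecewise ρ z)
  -- The label `n` marks the new block, where `y` differs from `ρ`; the label `n + 1` collects the
  -- coordinates that belong to no block.
  refine ⟨M.piecewise ρ z, fun v => if v ∈ M then (if y v = ρ v then n + 1 else n) else
    if β v < n then β v else n + 1, fun i hi => ?_⟩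
  rcases Nat.lt_succ_iff_lt_or_eq.mp hi with hi | rfl
  · convert h i hi using 2
    funext v
    by_cases hv : v ∈ M
    · by_cases hyv : y v = ρ v
      · simp [flipBlocks, hv, hyv, (show n + 1 ≠ i by omega)]
      · simp [flipBlocks, hv, hyv, hi.ne']
    · by_cases hβ : β v < n
      · simp [flipBlocks, hv, hβ]
      · simp [flipBlocks, hv, hβ, (show n + 1 ≠ i by omega), (show β v ≠ i by omega)]
  · convert hne using 2
    funext v
    by_cases hv : v ∈ M
    · by_cases hyv : y v = ρ v
      · simp [flipBlocks, hv, hyv]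
      · simp only [flipBlocks, hv, hyv, if_true, if_false, Finset.mem_singleton,
          Finset.piecewise_eq_of_mem]
        revert hyv
        cases y v <;> cases ρ v <;> simp
    · by_cases hβ : β v < i
      · simp [flipBlocks, hv, hβ, hβ.ne, hy v hv]
      · simp [flipBlocks, hv, hβ, hy v hv]

/-- A Boolean function of degree `k` and block sensitivity at most `s` has decision tree depth at
most `k * s`. -/
theorem hasTree_of_not_hasSensitiveBlocks {k s : ℕ} {f : Cube N → ℝ} (hf : f ∈ degreeLE N k)
    (h01 : ∀ x, f x = 0 ∨ f x = 1) (hs : ¬ HasSensitiveBlocks f (s + 1)) :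
    HasTree (k * s) f := by
  induction s generalizing f with
  | zero =>
    by_cases hc : ∀ x y, f x = f y
    · rcases h01 fun _ => false with h | h
      · exact .zero fun x => (hc _ _).trans h
      · exact .one fun x => (hc _ _).trans h
    · obtain ⟨M, -, hM⟩ := exists_card_le_forall_exists_ne hf hc
      exact absurd (hasSensitiveBlocks_succ hM (fun _ => false)
        ⟨fun _ => false, fun _ => 0, fun i hi => absurd hi (Nat.not_lt_zero i)⟩) hs
  | succ s ih =>
    by_cases hc : ∀ x y, f x = f y
    · rcases h01 fun _ => false with h | h
      · exact .zero fun x => (hc _ _).trans h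
      · exact .one fun x => (hc _ _).trans h
    · obtain ⟨M, hMk, hM⟩ := exists_card_le_forall_exists_ne hf hc
      refine HasTree.mono (HasTree.of_piecewise (d := k * s) M fun ρ => ?_)
        (by rw [Nat.mul_succ]; omega)
      exact ih (comp_piecewise_mem_degreeLE hf M ρ) (fun x => h01 _)
        fun hS => hs (hasSensitiveBlocks_succ hM ρ hS)

/-- A Boolean function of degree `k` has decision tree depth at most `k ^ 3`. -/
theorem hasTree_of_mem_degreeLE {k : ℕ} {f : Cube N → ℝ} (hf : f ∈ degreeLE N k)
    (h01 : ∀ x, f x = 0 ∨ f x = 1) : HasTree (k ^ 3) f := by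
  have := hasTree_of_not_hasSensitiveBlocks (s := k ^ 2) hf h01
    fun h => absurd (h.le_sq hf h01) (by omega)
  rwa [← pow_succ'] at this

end Trees

/-! ## The learner: one specialist for every coordinate, label and conjunction -/

/-- The value of a literal: `2 i` stands for `x i`, and `2 i + 1` for its negation. -/
def literal (y : ℕ → Bool) (j : ℕ) : ℝ := if y (j / 2) = decide (j % 2 = 0) then 1 else 0

/-- The conjunctions of literals, in the order of a heap with `2 N` children at each node. -/
def feature (N : ℕ) (y : ℕ → Bool) : ℕ → ℝ
  | 0 => 1
  | c + 1 => feature N y (c / (2 * N)) * literal y (c % (2 * N))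
decreasing_by exact Nat.lt_succ_of_le (Nat.div_le_self _ _)

/-- Overwrite the first `n` entries of a sequence. -/
def overwrite (n : ℕ) (F g : ℕ → ℝ) : ℕ → ℝ := fun q => if q < n then F q else g q

/-- The point that is played if the accumulated discrepancy is `s`. -/
def roundUp (s : ℕ → ℝ) : ℕ → Bool := fun i => decide (0 < s i)

/-- The total weight `Q` of the specialists for coordinate `i` that are awake at `y`. -/
def awakeWeight (N W : ℕ) (Q : ℕ → ℝ) (y : ℕ → Bool) (i : ℕ) : ℝ :=
  ∑ c ∈ range W, feature N y c * Q (i * W + c)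

/-- The prediction for coordinate `i` at `y`, from the weights of the specialists for label `1`
and for label `0`. -/
def predict (N W : ℕ) (Q₁ Q₀ : ℕ → ℝ) (y : ℕ → Bool) (i : ℕ) : ℝ :=
  awakeWeight N W Q₁ y i / (awakeWeight N W Q₁ y i + awakeWeight N W Q₀ y i)

/-- The next accumulated discrepancy between predictions and played points. -/
def stepDiscrepancy (N W : ℕ) (Q₁ Q₀ : ℕ → ℝ) (s : ℕ → ℝ) : ℕ → ℝ :=
  overwrite N (fun i => s i + (predict N W Q₁ Q₀ (roundUp s) i - if roundUp s i then 1 else 0)) s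

def discrepancy (N W : ℕ) (Q₁ Q₀ : ℕ → ℝ) (s : ℕ → ℝ) (l : ℕ) : ℕ → ℝ :=
  (stepDiscrepancy N W Q₁ Q₀)^[l] s

/-- The `l`-th point of the list that is played. -/
def played (N W : ℕ) (Q₁ Q₀ : ℕ → ℝ) (s : ℕ → ℝ) (l : ℕ) : ℕ → Bool :=
  roundUp (discrepancy N W Q₁ Q₀ s l)

/-- The average over the first `l` of `L` played points of the gain of the specialist `q` for
label `b`. -/
def gain (N W L : ℕ) (b : ℝ) (Q₁ Q₀ : ℕ → ℝ) (s : ℕ → ℝ) (l : ℕ) (q : ℕ) : ℝ :=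
  ∑ m ∈ range l, feature N (played N W Q₁ Q₀ s m) (q % W) *
    ((b - predict N W Q₁ Q₀ (played N W Q₁ Q₀ s m) (q / W)) / L)

/-- What the learner remembers from one round to the next. -/
structure LearnerState where
  weight₁ : ℕ → ℝ
  weight₀ : ℕ → ℝ
  gain₁ : ℕ → ℝ
  gain₀ : ℕ → ℝ
  disc : ℕ → ℝ

namespace LearnerState

/-- Truncated accumulation of the gains. -/
def accumulate (N W : ℕ) (u G Q : ℕ → ℝ) : ℕ → ℝ :=
  overwrite (N * W) (fun q => max (Q q + u (q / W) * G q) 0) Q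

/-- One round: learn from the utilities `u` of the preceding round, and play. -/
def round (N W L : ℕ) (u : ℕ → ℝ) (c : LearnerState) : LearnerState :=
  let Q₁ := accumulate N W u c.gain₁ c.weight₁
  let Q₀ := accumulate N W u c.gain₀ c.weight₀
  { weight₁ := Q₁
    weight₀ := Q₀
    gain₁ := overwrite (N * W) (gain N W L 1 Q₁ Q₀ c.disc L) c.gain₁
    gain₀ := overwrite (N * W) (gain N W L 0 Q₁ Q₀ c.disc L) c.gain₀
    disc := discrepancy N W Q₁ Q₀ c.disc L }

def initial : LearnerState := ⟨0, 0, 0, 0, 0⟩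

/-- The state before round `t`, if `v t` is the utility vector known at that time. -/
def after (N W L : ℕ) (v : ℕ → ℕ → ℝ) : ℕ → LearnerState
  | 0 => initial
  | t + 1 => round N W L (v t) (after N W L v t)

end LearnerState

/-! ## Elementary properties -/

section Basic

variable {N W : ℕ}

theorem literal_mem_Icc (y : ℕ → Bool) (j : ℕ) : literal y j ∈ Set.Icc (0 : ℝ) 1 := by
  unfold literal
  split_ifs <;> simp

theorem feature_mem_Icc (N : ℕ) (y : ℕ → Bool) (c : ℕ) : feature N y c ∈ Set.Icc (0 : ℝ) 1 := by
  induction c using Nat.strong_induction_on with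
  | _ c ih =>
    cases c with
    | zero => simp [feature]
    | succ c =>
      rw [feature]
      have h1 := ih (c / (2 * N)) (Nat.lt_succ_of_le (Nat.div_le_self _ _))
      have h2 := literal_mem_Icc y (c % (2 * N))
      exact ⟨mul_nonneg h1.1 h2.1, mul_le_one₀ h1.2 h2.1 h2.2⟩

theorem feature_child (y : ℕ → Bool) (c : ℕ) {j : ℕ} (hj : j < 2 * N) :
    feature N y (2 * N * c + j + 1) = feature N y c * literal y j := by
  rw [feature, Nat.mul_add_div (by omega), Nat.div_eq_of_lt hj, Nat.mul_add_mod,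
    Nat.mod_eq_of_lt hj, add_zero]

theorem overwrite_of_lt {n q : ℕ} (h : q < n) (F g : ℕ → ℝ) : overwrite n F g q = F q :=
  if_pos h

theorem overwrite_of_le {n q : ℕ} (h : n ≤ q) (F g : ℕ → ℝ) : overwrite n F g q = g q :=
  if_neg (not_lt.mpr h)

theorem index_lt {i c : ℕ} (hi : i < N) (hc : c < W) : i * W + c < N * W := by
  calc i * W + c < i * W + W := by omega
    _ = (i + 1) * W := by ring
    _ ≤ N * W := Nat.mul_le_mul_right _ hi

theorem index_div {i c : ℕ} (hc : c < W) : (i * W + c) / W = i := by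
  rw [mul_comm, Nat.mul_add_div (by omega), Nat.div_eq_of_lt hc, add_zero]

theorem index_mod {i c : ℕ} (hc : c < W) : (i * W + c) % W = c := by
  rw [mul_comm, Nat.mul_add_mod, Nat.mod_eq_of_lt hc]

theorem awakeWeight_nonneg {Q : ℕ → ℝ} (hQ : ∀ q, 0 ≤ Q q) (y : ℕ → Bool) (i : ℕ) :
    0 ≤ awakeWeight N W Q y i :=
  sum_nonneg fun c _ => mul_nonneg (feature_mem_Icc N y c).1 (hQ _)

theorem predict_mem_Icc {Q₁ Q₀ : ℕ → ℝ} (h₁ : ∀ q, 0 ≤ Q₁ q) (h₀ : ∀ q, 0 ≤ Q₀ q)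
    (y : ℕ → Bool) (i : ℕ) : predict N W Q₁ Q₀ y i ∈ Set.Icc (0 : ℝ) 1 := by
  have a := awakeWeight_nonneg (N := N) (W := W) h₁ y i
  have b := awakeWeight_nonneg (N := N) (W := W) h₀ y i
  exact ⟨div_nonneg a (add_nonneg a b), div_le_one_of_le₀ (by linarith) (add_nonneg a b)⟩

/-- The gains of the specialists cancel, at every point. -/
theorem awakeWeight_mul_add {Q₁ Q₀ : ℕ → ℝ} (h₁ : ∀ q, 0 ≤ Q₁ q) (h₀ : ∀ q, 0 ≤ Q₀ q)
    (y : ℕ → Bool) (i : ℕ) :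
    awakeWeight N W Q₁ y i * (1 - predict N W Q₁ Q₀ y i) +
      awakeWeight N W Q₀ y i * (0 - predict N W Q₁ Q₀ y i) = 0 := by
  have a := awakeWeight_nonneg (N := N) (W := W) h₁ y i
  have b := awakeWeight_nonneg (N := N) (W := W) h₀ y i
  unfold predict
  by_cases h : awakeWeight N W Q₁ y i + awakeWeight N W Q₀ y i = 0
  -- Nobody is awake: the prediction is `0 / 0 = 0`, and both terms vanish.
  · have : awakeWeight N W Q₁ y i = 0 := by linarith
    simp [this]
  · field_simp
    ring

theorem discrepancy_succ (Q₁ Q₀ s : ℕ → ℝ) (l : ℕ) :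
    discrepancy N W Q₁ Q₀ s (l + 1) =
      stepDiscrepancy N W Q₁ Q₀ (discrepancy N W Q₁ Q₀ s l) :=
  Function.iterate_succ_apply' _ _ _

/-- A positive discrepancy is rounded to the point `1` and does not increase; a nonpositive one is
rounded to `0` and does not decrease. In both cases it moves by at most one, towards or past zero,
and so remains in `[-1, 1]`. -/
theorem abs_stepDiscrepancy_le {Q₁ Q₀ s : ℕ → ℝ} (h₁ : ∀ q, 0 ≤ Q₁ q) (h₀ : ∀ q, 0 ≤ Q₀ q)
    (hs : ∀ i, |s i| ≤ 1) (i : ℕ) : |stepDiscrepancy N W Q₁ Q₀ s i| ≤ 1 := by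
  unfold stepDiscrepancy
  rcases lt_or_ge i N with hi | hi
  · rw [overwrite_of_lt hi]
    have hp := predict_mem_Icc (N := N) (W := W) h₁ h₀ (roundUp s) i
    have hsi := abs_le.mp (hs i)
    by_cases h : 0 < s i
    · simp only [roundUp, h, decide_true, if_true] at hp ⊢
      rw [abs_le]
      constructor <;> linarith [hp.1, hp.2]
    · simp only [roundUp, h, decide_false] at hp ⊢
      rw [abs_le]
      constructor <;> simp only [Bool.false_eq_true, if_false] <;> linarith [hp.1, hp.2]
  · rw [overwrite_of_le hi]
    exact hs i

theorem abs_discrepancy_le {Q₁ Q₀ s : ℕ → ℝ} (h₁ : ∀ q, 0 ≤ Q₁ q) (h₀ : ∀ q, 0 ≤ Q₀ q)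
    (hs : ∀ i, |s i| ≤ 1) (l i : ℕ) : |discrepancy N W Q₁ Q₀ s l i| ≤ 1 := by
  induction l generalizing i with
  | zero => exact hs i
  | succ l ih => rw [discrepancy_succ]; exact abs_stepDiscrepancy_le h₁ h₀ ih i

/-- The sum telescopes. With the bound on the discrepancy, this makes the list of played points an
approximate fixed point, on average, of the prediction map. -/
theorem sum_predict_sub (Q₁ Q₀ s : ℕ → ℝ) {i : ℕ} (hi : i < N) (L : ℕ) :
    ∑ l ∈ range L, (predict N W Q₁ Q₀ (played N W Q₁ Q₀ s l) i -
      if played N W Q₁ Q₀ s l i then 1 else 0) = discrepancy N W Q₁ Q₀ s L i - s i := by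
  have : ∀ l, predict N W Q₁ Q₀ (played N W Q₁ Q₀ s l) i -
      (if played N W Q₁ Q₀ s l i then 1 else 0) =
      discrepancy N W Q₁ Q₀ s (l + 1) i - discrepancy N W Q₁ Q₀ s l i := by
    intro l
    rw [discrepancy_succ, stepDiscrepancy, overwrite_of_lt hi, played]
    ring
  rw [Finset.sum_congr rfl fun l _ => this l,
    Finset.sum_range_sub (fun l => discrepancy N W Q₁ Q₀ s l i)]
  rfl

theorem abs_gain_le {b : ℝ} (hb : b ∈ Set.Icc (0 : ℝ) 1) {Q₁ Q₀ : ℕ → ℝ} (h₁ : ∀ q, 0 ≤ Q₁ q)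
    (h₀ : ∀ q, 0 ≤ Q₀ q) (s : ℕ → ℝ) (L q : ℕ) : |gain N W L b Q₁ Q₀ s L q| ≤ 1 := by
  refine (Finset.abs_sum_le_sum_abs _ _).trans ?_
  have : ∀ m ∈ range L, |feature N (played N W Q₁ Q₀ s m) (q % W) *
      ((b - predict N W Q₁ Q₀ (played N W Q₁ Q₀ s m) (q / W)) / L)| ≤ 1 / L := by
    intro m _
    have hf := feature_mem_Icc N (played N W Q₁ Q₀ s m) (q % W)
    have hp := predict_mem_Icc (N := N) (W := W) h₁ h₀ (played N W Q₁ Q₀ s m) (q / W)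
    rw [abs_mul, abs_of_nonneg hf.1, abs_div, Nat.abs_cast]
    have : |b - predict N W Q₁ Q₀ (played N W Q₁ Q₀ s m) (q / W)| ≤ 1 := by
      rw [abs_le]
      constructor <;> linarith [hb.1, hb.2, hp.1, hp.2]
    refine (mul_le_of_le_one_left (by positivity) hf.2).trans ?_
    gcongr
  refine (Finset.sum_le_sum this).trans ?_
  rw [Finset.sum_const, Finset.card_range, nsmul_eq_mul, mul_one_div]
  exact div_self_le_one _

/-- Exchange the sums over conjunctions and played points: the gains cancel at each point. The
utility plays no part, so this is available before it is revealed. -/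
theorem sum_weight_mul_gain {Q₁ Q₀ : ℕ → ℝ} (h₁ : ∀ q, 0 ≤ Q₁ q) (h₀ : ∀ q, 0 ≤ Q₀ q)
    (s : ℕ → ℝ) (L i : ℕ) :
    ∑ c ∈ range W, (Q₁ (i * W + c) * gain N W L 1 Q₁ Q₀ s L (i * W + c) +
      Q₀ (i * W + c) * gain N W L 0 Q₁ Q₀ s L (i * W + c)) = 0 := by
  have : ∀ c ∈ range W, Q₁ (i * W + c) * gain N W L 1 Q₁ Q₀ s L (i * W + c) +
      Q₀ (i * W + c) * gain N W L 0 Q₁ Q₀ s L (i * W + c) =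
      ∑ m ∈ range L, (feature N (played N W Q₁ Q₀ s m) c * Q₁ (i * W + c) *
          (1 - predict N W Q₁ Q₀ (played N W Q₁ Q₀ s m) i) / L +
        feature N (played N W Q₁ Q₀ s m) c * Q₀ (i * W + c) *
          (0 - predict N W Q₁ Q₀ (played N W Q₁ Q₀ s m) i) / L) := by
    intro c hc
    rw [Finset.mem_range] at hc
    rw [gain, gain, index_div hc, index_mod hc, Finset.mul_sum, Finset.mul_sum,
      ← Finset.sum_add_distrib]
    exact Finset.sum_congr rfl fun m _ => by ring
  rw [Finset.sum_congr rfl this, Finset.sum_comm]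
  refine Finset.sum_eq_zero fun m _ => ?_
  have h := awakeWeight_mul_add (N := N) (W := W) h₁ h₀ (played N W Q₁ Q₀ s m) i
  rw [Finset.sum_add_distrib, ← Finset.sum_div, ← Finset.sum_div, ← Finset.sum_mul,
    ← Finset.sum_mul, ← add_div]
  unfold awakeWeight at h
  rw [h, zero_div]

/-- Truncation at zero can only lower the square. -/
theorem max_zero_sq_le (a d : ℝ) : (max (a + d) 0) ^ 2 ≤ a ^ 2 + 2 * (a * d) + d ^ 2 := by
  rcases le_total (a + d) 0 with h | h
  · rw [max_eq_right h]
    nlinarith [sq_nonneg (a + d)]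
  · rw [max_eq_left h]
    nlinarith

end Basic

/-! ## Regret -/

namespace LearnerState

variable {N W L : ℕ} {v : ℕ → ℕ → ℝ}

theorem accumulate_nonneg {u G Q : ℕ → ℝ} (hQ : ∀ q, 0 ≤ Q q) (q : ℕ) :
    0 ≤ accumulate N W u G Q q := by
  unfold accumulate overwrite
  split_ifs
  · exact le_max_right _ _
  · exact hQ q

theorem after_nonneg (t : ℕ) :
    (∀ q, 0 ≤ (after N W L v t).weight₁ q) ∧ (∀ q, 0 ≤ (after N W L v t).weight₀ q) := by
  induction t with
  | zero => exact ⟨fun _ => le_rfl, fun _ => le_rfl⟩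
  | succ t ih => exact ⟨accumulate_nonneg ih.1, accumulate_nonneg ih.2⟩

theorem abs_disc_le (t i : ℕ) : |(after N W L v t).disc i| ≤ 1 := by
  induction t generalizing i with
  | zero => simp [after, initial]
  | succ t ih =>
    exact abs_discrepancy_le (after_nonneg (v := v) (t + 1)).1 (after_nonneg (v := v) (t + 1)).2
      ih L i

theorem gain₁_succ {i c : ℕ} (hi : i < N) (hc : c < W) (t : ℕ) :
    (after N W L v (t + 1)).gain₁ (i * W + c) = gain N W L 1 (after N W L v (t + 1)).weight₁
      (after N W L v (t + 1)).weight₀ (after N W L v t).disc L (i * W + c) :=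
  overwrite_of_lt (index_lt hi hc) _ _

theorem gain₀_succ {i c : ℕ} (hi : i < N) (hc : c < W) (t : ℕ) :
    (after N W L v (t + 1)).gain₀ (i * W + c) = gain N W L 0 (after N W L v (t + 1)).weight₁
      (after N W L v (t + 1)).weight₀ (after N W L v t).disc L (i * W + c) :=
  overwrite_of_lt (index_lt hi hc) _ _

theorem weight₁_succ {i c : ℕ} (hi : i < N) (hc : c < W) (t : ℕ) :
    (after N W L v (t + 1)).weight₁ (i * W + c) = max ((after N W L v t).weight₁ (i * W + c) +
      v t i * (after N W L v t).gain₁ (i * W + c)) 0 := by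
  change accumulate N W _ _ _ _ = _
  rw [accumulate, overwrite_of_lt (index_lt hi hc), index_div hc]

theorem weight₀_succ {i c : ℕ} (hi : i < N) (hc : c < W) (t : ℕ) :
    (after N W L v (t + 1)).weight₀ (i * W + c) = max ((after N W L v t).weight₀ (i * W + c) +
      v t i * (after N W L v t).gain₀ (i * W + c)) 0 := by
  change accumulate N W _ _ _ _ = _
  rw [accumulate, overwrite_of_lt (index_lt hi hc), index_div hc]

/-- The weights grow slowly. -/
theorem sum_sq_weight_le {i : ℕ} (hi : i < N) (hv : ∀ t, |v t i| ≤ 1) (T : ℕ) :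
    ∑ c ∈ range W, ((after N W L v (T + 1)).weight₁ (i * W + c) ^ 2 +
      (after N W L v (T + 1)).weight₀ (i * W + c) ^ 2) ≤ 2 * W * T := by
  induction T with
  | zero =>
    -- The update before the first round is made with zero gains, so all weights are still zero.
    rw [Finset.sum_eq_zero]
    · simp
    · intro c hc
      rw [Finset.mem_range] at hc
      rw [weight₁_succ hi hc, weight₀_succ hi hc]
      simp [after, initial]
  | succ T ih =>
    have hn := after_nonneg (N := N) (W := W) (L := L) (v := v) (T + 1)
    have h0 := sum_weight_mul_gain (N := N) (W := W) hn.1 hn.2 (after N W L v T).disc L i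
    have hv2 : v (T + 1) i ^ 2 ≤ 1 := (sq_le_one_iff_abs_le_one _).mpr (hv _)
    have key : ∀ c ∈ range W, (after N W L v (T + 1 + 1)).weight₁ (i * W + c) ^ 2 +
        (after N W L v (T + 1 + 1)).weight₀ (i * W + c) ^ 2 ≤
        ((after N W L v (T + 1)).weight₁ (i * W + c) ^ 2 +
          (after N W L v (T + 1)).weight₀ (i * W + c) ^ 2) +
        2 * v (T + 1) i * ((after N W L v (T + 1)).weight₁ (i * W + c) *
          gain N W L 1 (after N W L v (T + 1)).weight₁ (after N W L v (T + 1)).weight₀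
            (after N W L v T).disc L (i * W + c) + (after N W L v (T + 1)).weight₀ (i * W + c) *
          gain N W L 0 (after N W L v (T + 1)).weight₁ (after N W L v (T + 1)).weight₀
            (after N W L v T).disc L (i * W + c)) + 2 := by
      intro c hc
      rw [Finset.mem_range] at hc
      rw [weight₁_succ hi hc, weight₀_succ hi hc, gain₁_succ hi hc, gain₀_succ hi hc]
      have g1 := abs_gain_le (N := N) (W := W) (b := 1) (by simp) hn.1 hn.2
        (after N W L v T).disc L (i * W + c)
      have g0 := abs_gain_le (N := N) (W := W) (b := 0) (by simp) hn.1 hn.2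
        (after N W L v T).disc L (i * W + c)
      rw [← sq_le_one_iff_abs_le_one] at g1 g0
      refine (add_le_add (max_zero_sq_le _ _) (max_zero_sq_le _ _)).trans ?_
      rw [mul_pow, mul_pow]
      have a1 := mul_le_one₀ hv2 (sq_nonneg _) g1
      have a0 := mul_le_one₀ hv2 (sq_nonneg _) g0
      linarith
    -- The cross terms sum to zero by `h0`. What remains is an increase of at most `2` per
    -- conjunction, `1` for each label.
    refine (Finset.sum_le_sum key).trans ?_
    rw [Finset.sum_add_distrib, Finset.sum_add_distrib, ← Finset.mul_sum, h0]
    simp only [Finset.sum_const, Finset.card_range, nsmul_eq_mul]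
    push_cast
    linarith

theorem weight_le_sqrt {i c : ℕ} (hi : i < N) (hc : c < W) (hv : ∀ t, |v t i| ≤ 1) (T : ℕ) :
    (after N W L v (T + 1)).weight₁ (i * W + c) ≤ √(2 * W * T) ∧
      (after N W L v (T + 1)).weight₀ (i * W + c) ≤ √(2 * W * T) := by
  have h := sum_sq_weight_le (W := W) (L := L) hi hv T
  have h1 := (Finset.single_le_sum (f := fun c =>
    (after N W L v (T + 1)).weight₁ (i * W + c) ^ 2 +
      (after N W L v (T + 1)).weight₀ (i * W + c) ^ 2)
    (fun c _ => add_nonneg (sq_nonneg _) (sq_nonneg _)) (Finset.mem_range.mpr hc)).trans h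
  exact ⟨Real.le_sqrt_of_sq_le (by nlinarith [sq_nonneg ((after N W L v (T + 1)).weight₀
      (i * W + c))]), Real.le_sqrt_of_sq_le (by nlinarith [sq_nonneg ((after N W L v
      (T + 1)).weight₁ (i * W + c))])⟩

/-- The weight is the sum of the gains except that truncation has sometimes raised it. -/
theorem sum_gain_le {i c : ℕ} (hi : i < N) (hc : c < W) (T : ℕ) :
    ∑ t ∈ range T, v (t + 1) i * (after N W L v (t + 1)).gain₁ (i * W + c) ≤
        (after N W L v (T + 1)).weight₁ (i * W + c) ∧
      ∑ t ∈ range T, v (t + 1) i * (after N W L v (t + 1)).gain₀ (i * W + c) ≤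
        (after N W L v (T + 1)).weight₀ (i * W + c) := by
  induction T with
  | zero =>
    exact ⟨(after_nonneg (N := N) (W := W) (L := L) (v := v) 1).1 _,
      (after_nonneg (N := N) (W := W) (L := L) (v := v) 1).2 _⟩
  | succ T ih =>
    rw [Finset.sum_range_succ, Finset.sum_range_succ, weight₁_succ hi hc, weight₀_succ hi hc]
    exact ⟨le_max_of_le_left (by linarith [ih.1]), le_max_of_le_left (by linarith [ih.2])⟩

end LearnerState

/-! ### From specialists to decision trees -/

section Tree

variable {N : ℕ}

def restrict (N : ℕ) (y : ℕ → Bool) : Cube N := fun i => y i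

theorem feature_eq_add (y : ℕ → Bool) (c i : ℕ) (hi : i < N) :
    feature N y c = feature N y (2 * N * c + 2 * i + 1) +
      feature N y (2 * N * c + (2 * i + 1) + 1) := by
  rw [feature_child y c (by omega), feature_child y c (by omega), ← mul_add]
  have : literal y (2 * i) + literal y (2 * i + 1) = 1 := by
    have h2 : (2 * i + 1) / 2 = i := by omega
    have h3 : (2 * i + 1) % 2 ≠ 0 := by omega
    have h4 : 2 * i / 2 = i := by omega
    simp only [literal, h2, h3, h4]
    cases y i <;> simp
  rw [this, mul_one]

/-- Small regret of all specialists implies small regret against decision trees. -/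
theorem HasTree.regret_le {α : Type*} (S : Finset α) (w φ : α → ℝ) (y : α → ℕ → Bool) {B : ℝ}
    (hB : 0 ≤ B) {D : ℕ}
    (h : ∀ c < (2 * N + 1) ^ D, ∑ a ∈ S, w a * (feature N (y a) c * (1 - φ a)) ≤ B ∧
      ∑ a ∈ S, w a * (feature N (y a) c * (0 - φ a)) ≤ B)
    {d : ℕ} {f : Cube N → ℝ} (hf : HasTree d f) {r c : ℕ} (hc : c + 1 ≤ (2 * N + 1) ^ r)
    (hr : r + d ≤ D) :
    ∑ a ∈ S, w a * (feature N (y a) c * (f (restrict N (y a)) - φ a)) ≤ 2 ^ d * B := by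
  induction hf generalizing r c with
  | @zero d f hf =>
    simp only [hf]
    have hcD : c < (2 * N + 1) ^ D :=
      lt_of_lt_of_le hc (Nat.pow_le_pow_right (by omega) (by omega))
    exact (h c hcD).2.trans (le_mul_of_one_le_left hB (one_le_pow₀ one_le_two))
  | @one d f hf =>
    simp only [hf]
    have hcD : c < (2 * N + 1) ^ D :=
      lt_of_lt_of_le hc (Nat.pow_le_pow_right (by omega) (by omega))
    exact (h c hcD).1.trans (le_mul_of_one_le_left hB (one_le_pow₀ one_le_two))
  | @node d f v hf ih =>
    have hv := v.isLt
    -- In the heap order the children of `c` are `2 N c + j + 1`, so index plus one grows by a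
    -- factor of at most `2 N + 1` per level. Hence every conjunction of at most `D` literals used
    -- by the tree has index below `(2 N + 1) ^ D`.
    have hidx : ∀ j < 2 * N, 2 * N * c + j + 1 + 1 ≤ (2 * N + 1) ^ (r + 1) := by
      intro j hj
      rw [pow_succ]
      calc 2 * N * c + j + 1 + 1 ≤ (c + 1) * (2 * N + 1) := by ring_nf; omega
        _ ≤ _ := Nat.mul_le_mul_right _ hc
    have h1 := ih true (r := r + 1) (hidx (2 * v) (by omega)) (by omega)
    have h0 := ih false (r := r + 1) (hidx (2 * v + 1) (by omega)) (by omega)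
    have hsplit : ∑ a ∈ S, w a * (feature N (y a) c * (f (restrict N (y a)) - φ a)) =
        ∑ a ∈ S, w a * (feature N (y a) (2 * N * c + 2 * v + 1) *
          (f (Function.update (restrict N (y a)) v true) - φ a)) +
        ∑ a ∈ S, w a * (feature N (y a) (2 * N * c + (2 * v + 1) + 1) *
          (f (Function.update (restrict N (y a)) v false) - φ a)) := by
      rw [← Finset.sum_add_distrib]
      refine Finset.sum_congr rfl fun a _ => ?_
      rw [feature_eq_add (y a) c v hv]
      have key : ∀ b, restrict N (y a) v = b →
          Function.update (restrict N (y a)) v b = restrict N (y a) := by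
        rintro _ rfl
        exact Function.update_eq_self _ _
      have h2 : (2 * (v : ℕ) + 1) / 2 = v := by omega
      have h3 : (2 * (v : ℕ) + 1) % 2 ≠ 0 := by omega
      cases hyv : y a v with
      | true =>
        have hz : feature N (y a) (2 * N * c + (2 * v + 1) + 1) = 0 := by
          rw [feature_child (y a) c (by omega)]
          simp [literal, h2, hyv]
        rw [hz, key true hyv]
        ring
      | false =>
        have hz : feature N (y a) (2 * N * c + 2 * v + 1) = 0 := by
          rw [feature_child (y a) c (by omega)]
          simp [literal, hyv]
        rw [hz, key false hyv]
        ring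
    rw [hsplit, pow_succ]
    linarith

end Tree

/-! ## The regret of the learner -/

section Regret

variable {N : ℕ}

/-- Test `u` on the indicator of its positive coordinates and on that of its negative coordinates.
-/
theorem sum_abs_le_two {u : Fin N → ℝ} (hu : u ∈ utilities N) : ∑ i, |u i| ≤ 2 := by
  have h1 := (abs_le.mp (hu fun i => decide (0 < u i))).2
  have h2 := (abs_le.mp (hu fun i => decide (u i < 0))).1
  have : ∀ i, |u i| = u i * Cube.vec (fun i => decide (0 < u i)) i -
      u i * Cube.vec (fun i => decide (u i < 0)) i := by
    intro i
    rcases lt_trichotomy (u i) 0 with h | h | h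
    · simp [Cube.vec, h, h.not_gt, abs_of_neg]
    · simp [h]
    · simp [Cube.vec, h, h.not_gt, abs_of_pos]
  rw [Finset.sum_congr rfl fun i _ => this i, Finset.sum_sub_distrib]
  linarith

theorem abs_le_one {u : Fin N → ℝ} (hu : u ∈ utilities N) (i : Fin N) : |u i| ≤ 1 := by
  have h := hu fun j => decide (j = i)
  simpa [Cube.vec] using h

/-- The uniform distribution on the first `L` played points. -/
def strategy (N W L : ℕ) (Q₁ Q₀ s : ℕ → ℝ) (x : Cube N) : ℝ :=
  ∑ l ∈ range L with x = restrict N (played N W Q₁ Q₀ s l), (1 / L : ℝ)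

theorem sum_strategy_mul (W L : ℕ) (Q₁ Q₀ s : ℕ → ℝ) (g : Cube N → ℝ) :
    ∑ x, strategy N W L Q₁ Q₀ s x * g x =
      ∑ l ∈ range L, 1 / L * g (restrict N (played N W Q₁ Q₀ s l)) := by
  simp only [strategy, Finset.sum_mul, Finset.sum_filter]
  rw [Finset.sum_comm' (t' := range L) (s' := fun _ => Finset.univ) (by simp)]
  refine Finset.sum_congr rfl fun l _ => ?_
  simp

theorem strategy_mem_stdSimplex (W : ℕ) {L : ℕ} (hL : 0 < L) (Q₁ Q₀ s : ℕ → ℝ) :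
    strategy N W L Q₁ Q₀ s ∈ stdSimplex ℝ (Cube N) := by
  constructor
  · intro x
    exact sum_nonneg fun _ _ => by positivity
  · have := sum_strategy_mul (N := N) W L Q₁ Q₀ s fun _ => 1
    simp only [mul_one] at this
    rw [this, Finset.sum_const, Finset.card_range, nsmul_eq_mul, mul_one_div_cancel]
    positivity

-- Insert the prediction between the deviation and the played point. The first difference is regret
-- against trees, the second is the rounding error. The sequence `v` is `u` delayed by one, because
-- a utility is processed at the start of the next round; hence the weights at `t + 1` but the
-- discrepancy at `t`.
open LearnerState in
theorem sum_deviationGain_le {D L : ℕ} (hL : 0 < L) {u : ℕ → Fin N → ℝ}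
    (hu : ∀ t, u t ∈ utilities N)
    {v : ℕ → ℕ → ℝ} (hv0 : v 0 = 0) (hv : ∀ t (i : Fin N), v (t + 1) i = u t i)
    {ϕ : Cube N → Cube N} (hϕ : ∀ i, HasTree D fun x => (ϕ x).vec i) (T : ℕ) :
    ∑ t ∈ range T, deviationGain (u t) (strategy N ((2 * N + 1) ^ D) L
      (after N ((2 * N + 1) ^ D) L v (t + 1)).weight₁
      (after N ((2 * N + 1) ^ D) L v (t + 1)).weight₀
      (after N ((2 * N + 1) ^ D) L v t).disc) ϕ ≤
    N * (2 ^ D * √(2 * ((2 * N + 1) ^ D : ℕ) * T)) + T * (4 / L) := by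
  set W := (2 * N + 1) ^ D with hW
  have hL' : (0 : ℝ) < L := by exact_mod_cast hL
  have hv1 : ∀ (i : Fin N) t, |v t i| ≤ 1 := by
    rintro i (_ | t)
    · simp [hv0]
    · rw [hv]; exact abs_le_one (hu t) i
  let y : ℕ → ℕ → ℕ → Bool := fun t => played N W (after N W L v (t + 1)).weight₁
      (after N W L v (t + 1)).weight₀ (after N W L v t).disc
  let p : ℕ → ℕ → ℕ → ℝ := fun t l => predict N W (after N W L v (t + 1)).weight₁
      (after N W L v (t + 1)).weight₀ (y t l)
  have hsplit : ∀ t ∈ range T, deviationGain (u t) (strategy N W L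
      (after N W L v (t + 1)).weight₁ (after N W L v (t + 1)).weight₀ (after N W L v t).disc) ϕ =
      ∑ i, ∑ l ∈ range L, u t i / L * ((ϕ (restrict N (y t l))).vec i - p t l i) +
      ∑ i, u t i / L * ∑ l ∈ range L, (p t l i - if y t l i then 1 else 0) := by
    intro t _
    rw [deviationGain, ← Finset.sum_add_distrib]
    refine Finset.sum_congr rfl fun i _ => ?_
    rw [sum_strategy_mul, Finset.mul_sum, Finset.mul_sum, ← Finset.sum_add_distrib]
    refine Finset.sum_congr rfl fun l _ => ?_
    have : (restrict N (y t l)).vec i = if y t l i then 1 else 0 := rfl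
    rw [← this]
    change u t i * (1 / L * ((ϕ (restrict N (y t l))).vec i - (restrict N (y t l)).vec i)) = _
    ring
  rw [Finset.sum_congr rfl hsplit, Finset.sum_add_distrib]
  refine add_le_add ?_ ?_
  · rw [Finset.sum_comm]
    have : ∀ i ∈ (Finset.univ : Finset (Fin N)), ∑ t ∈ range T, ∑ l ∈ range L,
        u t i / L * ((ϕ (restrict N (y t l))).vec i - p t l i) ≤ 2 ^ D * √(2 * W * T) := by
      intro i _
      -- All played points of all rounds are treated as one sample, weighted by `u t i / L`. The
      -- tree is rooted at conjunction `0`, which is identically `1`.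
      have := HasTree.regret_le (range T ×ˢ range L) (fun a => u a.1 i / L)
        (fun a => p a.1 a.2 i) (fun a => y a.1 a.2) (B := √(2 * W * T)) (Real.sqrt_nonneg _)
        (D := D) ?_ (hϕ i) (r := 0) (c := 0) (by simp) (by omega)
      · simpa [Finset.sum_product, feature] using this
      · intro c hc
        rw [← hW] at hc
        have h1 := weight_le_sqrt (L := L) (W := W) i.isLt hc (hv1 i) T
        have h2 := sum_gain_le (L := L) (W := W) (v := v) i.isLt hc T
        refine ⟨le_trans (le_of_eq ?_) (h2.1.trans h1.1),
          le_trans (le_of_eq ?_) (h2.2.trans h1.2)⟩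
        · rw [Finset.sum_product]
          refine Finset.sum_congr rfl fun t _ => ?_
          rw [gain₁_succ i.isLt hc, gain, hv, Finset.mul_sum]
          refine Finset.sum_congr rfl fun l _ => ?_
          rw [index_mod hc, index_div hc]
          ring
        · rw [Finset.sum_product]
          refine Finset.sum_congr rfl fun t _ => ?_
          rw [gain₀_succ i.isLt hc, gain, hv, Finset.mul_sum]
          refine Finset.sum_congr rfl fun l _ => ?_
          rw [index_mod hc, index_div hc]
          ring
    refine (Finset.sum_le_sum this).trans ?_
    simp
  · have : ∀ t ∈ range T, ∑ i : Fin N, u t i / L *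
        ∑ l ∈ range L, (p t l i - if y t l i then 1 else 0) ≤ 4 / L := by
      intro t _
      have hterm : ∀ i ∈ (Finset.univ : Finset (Fin N)), u t i / L *
          ∑ l ∈ range L, (p t l i - if y t l i then 1 else 0) ≤ |u t i| * (2 / L) := by
        intro i _
        have h := sum_predict_sub (W := W) (after N W L v (t + 1)).weight₁
          (after N W L v (t + 1)).weight₀ (after N W L v t).disc i.isLt L
        change ∑ l ∈ range L, (p t l i - if y t l i then 1 else 0) = _ at h
        rw [h]
        refine (le_abs_self _).trans ?_
        rw [abs_mul, abs_div, Nat.abs_cast]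
        have h1 : |discrepancy N W (after N W L v (t + 1)).weight₁
          (after N W L v (t + 1)).weight₀ (after N W L v t).disc L i| ≤ 1 :=
          abs_disc_le (v := v) (t + 1) i
        have h2 : |(after N W L v t).disc i| ≤ 1 := abs_disc_le t i
        calc _ ≤ |u t i| / L * 2 := by
              gcongr
              exact (abs_sub _ _).trans (by linarith)
          _ = _ := by ring
      refine (Finset.sum_le_sum hterm).trans ?_
      rw [← Finset.sum_mul]
      calc _ ≤ 2 * (2 / (L : ℝ)) := by gcongr; exact sum_abs_le_two (hu t)
        _ = _ := by ring
    refine (Finset.sum_le_sum this).trans ?_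
    simp

/-- The coordinates of a polynomial deviation have decision trees of depth
`min k N ^ 3`. -/
theorem hasTree_of_mem_polyDeviations {k : ℕ} {ϕ : Cube N → Cube N}
    (hϕ : ϕ ∈ polyDeviations N k) (i : Fin N) : HasTree (min k N ^ 3) fun x => (ϕ x).vec i := by
  refine hasTree_of_mem_degreeLE ?_ fun x => ?_
  · rcases le_total k N with h | h
    · rw [min_eq_left h]
      obtain ⟨p, hp, he⟩ := hϕ i
      simpa only [he] using eval_mem_degreeLE p hp
    · rw [min_eq_right h]
      exact mem_degreeLE_card _
  · unfold Cube.vec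
    cases ϕ x i <;> simp

-- Each of the two error terms gets half of `ε`. Since `N` and `2 ^ D` are at most `W`, the tree
-- term is at most `W ^ 2 * √(2 * W * T)`, which is below `T * ε / 2` once `T ≥ 8 * W ^ 5 / ε ^ 2`.
open LearnerState in
theorem avgRegret_le {k L T : ℕ} {ε : ℝ} (hε : 0 < ε) (hL : 8 / ε ≤ L)
    {u : ℕ → Fin N → ℝ} (hu : ∀ t, u t ∈ utilities N)
    {v : ℕ → ℕ → ℝ} (hv0 : v 0 = 0) (hv : ∀ t (i : Fin N), v (t + 1) i = u t i) {W : ℕ}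
    (hW : W = (2 * N + 1) ^ min k N ^ 3) (hN : N ≤ W)
    (hT : 8 * (W : ℝ) ^ 5 / ε ^ 2 ≤ T) :
    avgRegret (polyDeviations N k) u (fun t => strategy N W L (after N W L v (t + 1)).weight₁
      (after N W L v (t + 1)).weight₀ (after N W L v t).disc) T ≤ ε := by
  have hW0 : 0 < W := by rw [hW]; positivity
  have hW0' : (0 : ℝ) < W := by exact_mod_cast hW0
  have hT0 : (0 : ℝ) < T := lt_of_lt_of_le (by positivity) hT
  have hL0 : (0 : ℝ) < L := lt_of_lt_of_le (by positivity) hL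
  unfold avgRegret
  have hsup : (⨆ φ : polyDeviations N k, ∑ t ∈ range T, deviationGain (u t)
      (strategy N W L (after N W L v (t + 1)).weight₁
      (after N W L v (t + 1)).weight₀ (after N W L v t).disc) φ) ≤ T * ε := by
    refine Real.iSup_le (fun φ => ?_) (by positivity)
    have h := sum_deviationGain_le (L := L) (by exact_mod_cast hL0) hu hv0 hv
      (fun i => hasTree_of_mem_polyDeviations φ.2 i) T
    rw [← hW] at h
    refine h.trans ?_
    by_cases hN0 : N = 0
    · have : (T : ℝ) * (4 / L) ≤ T * ε := by
        gcongr
        rw [div_le_iff₀ hL0]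
        rw [div_le_iff₀ hε] at hL
        linarith
      subst hN0
      simpa using this
    have hpow : (2 : ℝ) ^ (min k N ^ 3) ≤ W := by
      rw [hW]
      push_cast
      gcongr
      have : (1 : ℝ) ≤ N := by exact_mod_cast Nat.one_le_iff_ne_zero.mpr hN0
      linarith
    have hN' : (N : ℝ) ≤ W := by exact_mod_cast hN
    have hsq : √(2 * W * T) ≤ T * ε / (2 * W ^ 2) := by
      refine Real.sqrt_le_iff.mpr ⟨by positivity, ?_⟩
      rw [div_pow, le_div_iff₀ (by positivity)]
      rw [div_le_iff₀ (by positivity)] at hT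
      calc 2 * (W : ℝ) * T * (2 * W ^ 2) ^ 2 = T * (8 * W ^ 5) := by ring
        _ ≤ T * (T * ε ^ 2) := by gcongr
        _ = _ := by ring
    have h1 : (N : ℝ) * (2 ^ min k N ^ 3 * √(2 * W * T)) ≤ T * ε / 2 := by
      calc _ ≤ (W : ℝ) * (W * (T * ε / (2 * W ^ 2))) := by gcongr
        _ = _ := by field_simp
    have h2 : (T : ℝ) * (4 / L) ≤ T * ε / 2 := by
      have : 4 / (L : ℝ) ≤ ε / 2 := by
        rw [div_le_iff₀ hL0]
        rw [div_le_iff₀ hε] at hL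
        linarith
      rw [mul_div_assoc]
      exact mul_le_mul_of_nonneg_left this hT0.le
    linarith
  calc _ ≤ 1 / (T : ℝ) * (T * ε) := by gcongr
    _ = ε := by field_simp

end Regret

/-! ## Reasoning about programs -/

/-- The program `p`, started with memory `σ`, halts after at most `n` steps, with a memory that
satisfies `Q`. -/
def Halts (p : Program) (n : ℕ) (Q : Memory → Prop) (σ : Memory) : Prop :=
  ∃ m τ, m ≤ n ∧ Exec p σ m τ ∧ Q τ

namespace Halts

variable {p q : Program} {m n : ℕ} {Q Q' : Memory → Prop} {σ : Memory}

theorem mono (h : Halts p m Q σ) (hQ : ∀ τ, Q τ → Q' τ) (hmn : m ≤ n) : Halts p n Q' σ := by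
  obtain ⟨c, τ, hc, he, hτ⟩ := h
  exact ⟨c, τ, hc.trans hmn, he, hQ τ hτ⟩

theorem mono_right (h : Halts p m Q σ) (hmn : m ≤ n) : Halts p n Q σ := h.mono (fun _ => id) hmn

theorem seq (h : Halts p m (Halts q n Q) σ) : Halts (.seq p q) (m + n) Q σ := by
  obtain ⟨c, τ, hc, he, d, ρ, hd, he', hρ⟩ := h
  exact ⟨c + d, ρ, add_le_add hc hd, .seq he he', hρ⟩

end Halts

namespace Program

/-- Programs without loops. -/
def straight : Program → Bool
  | nop => true
  | setNat _ _ _ => true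
  | setReal _ _ _ => true
  | seq p q => p.straight && q.straight
  | cond _ p q => p.straight && q.straight
  | loop _ _ => false

open Classical in
/-- The final memory, for programs without loops. -/
def run : Program → Memory → Memory
  | nop, σ => σ
  | setNat a i e, σ => σ.putNat a (i.eval σ) (e.eval σ)
  | setReal a i e, σ => σ.putReal a (i.eval σ) (e.eval σ)
  | seq p q, σ => q.run (p.run σ)
  | cond b p q, σ => if b.holds σ then p.run σ else q.run σ
  | loop _ _, σ => σ

/-- A bound for the number of steps, for programs without loops. -/
def steps : Program → ℕ
  | nop => 1
  | setNat _ i e => i.cost + e.cost + 1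
  | setReal _ i e => i.cost + e.cost + 1
  | seq p q => p.steps + q.steps
  | cond b p q => b.cost + (p.steps + q.steps) + 1
  | loop _ _ => 0

/-- `for a[0] = 0, 1, …` while `a[0] < b`. -/
def forLoop (a : ℕ) (b : NatExp) (p : Program) : Program :=
  .seq (.setNat a (.const 0) (.const 0)) (.loop (.natLt (.get a (.const 0)) b)
    (.seq p (.setNat a (.const 0) (.add (.get a (.const 0)) (.const 1)))))

end Program

/-- Reduces code without loops to evaluating `run`, which `simp` can do. -/
theorem Halts.run {p : Program} (hp : p.straight = true) {Q : Memory → Prop} {σ : Memory}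
    (h : Q (p.run σ)) : Halts p p.steps Q σ := by
  suffices ∃ m, m ≤ p.steps ∧ Exec p σ m (p.run σ) by
    obtain ⟨m, hm, he⟩ := this
    exact ⟨m, _, hm, he, h⟩
  clear h
  induction p generalizing σ with
  | nop => exact ⟨_, le_rfl, .nop σ⟩
  | setNat a i e => exact ⟨_, le_rfl, .setNat σ a i e⟩
  | setReal a i e => exact ⟨_, le_rfl, .setReal σ a i e⟩
  | seq p q ihp ihq =>
    simp only [Program.straight, Bool.and_eq_true] at hp
    obtain ⟨m, hm, he⟩ := ihp hp.1 (σ := σ)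
    obtain ⟨n, hn, he'⟩ := ihq hp.2 (σ := p.run σ)
    exact ⟨m + n, add_le_add hm hn, .seq he he'⟩
  | cond b p q ihp ihq =>
    simp only [Program.straight, Bool.and_eq_true] at hp
    by_cases hb : b.holds σ
    · obtain ⟨m, hm, he⟩ := ihp hp.1 (σ := σ)
      refine ⟨b.cost + m + 1, by simp only [Program.steps]; omega, ?_⟩
      rw [Program.run, if_pos hb]
      exact .condTrue hb he
    · obtain ⟨m, hm, he⟩ := ihq hp.2 (σ := σ)
      refine ⟨b.cost + m + 1, by simp only [Program.steps]; omega, ?_⟩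
      rw [Program.run, if_neg hb]
      exact .condFalse hb he
  | loop b p => simp [Program.straight] at hp

/-- A loop that runs `n` times through the memories `R 0, R 1, …`, which may depend on the values
`g` of auxiliary variables. -/
theorem Halts.loop {G : Type*} (R : ℕ → G → Memory) {b : Test} {p : Program} {n c : ℕ}
    {σ : Memory} (h0 : ∃ g, σ = R 0 g) (hb : ∀ i < n, ∀ g, b.holds (R i g))
    (hn : ∀ g, ¬ b.holds (R n g))
    (hp : ∀ i < n, ∀ g, Halts p c (fun τ => ∃ g', τ = R (i + 1) g') (R i g)) :
    Halts (.loop b p) (n * (b.cost + 1 + c) + (b.cost + 1)) (fun τ => ∃ g, τ = R n g) σ := by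
  suffices ∀ d ≤ n, ∀ g, Halts (.loop b p) (d * (b.cost + 1 + c) + (b.cost + 1))
      (fun τ => ∃ g, τ = R n g) (R (n - d) g) by
    obtain ⟨g, rfl⟩ := h0
    simpa using this n le_rfl g
  intro d
  induction d with
  | zero =>
    intro _ g
    exact ⟨_, _, by omega, .loopStop (hn g), g, rfl⟩
  | succ d ih =>
    intro hd g
    obtain ⟨m, τ, hm, he, g', rfl⟩ := hp (n - (d + 1)) (by omega) g
    rw [show n - (d + 1) + 1 = n - d by omega] at he
    obtain ⟨m', ρ, hm', he', hρ⟩ := ih (by omega) g'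
    refine ⟨_, ρ, ?_, .loopStep (hb _ (by omega) g) he he', hρ⟩
    rw [Nat.succ_mul]
    omega

/-- The bound is evaluated anew before each pass, so it must have the value `n` in every `R i g`.
The hypothesis on the body describes the memory after the counter has been incremented. -/
theorem Halts.forLoop {G : Type*} (R : ℕ → G → Memory) {a : ℕ} {b : NatExp} {p : Program}
    {n c : ℕ} {σ : Memory} (h0 : ∃ g, σ.putNat a 0 0 = R 0 g)
    (ha : ∀ i g, (R i g).nat a 0 = i) (hb : ∀ i g, b.eval (R i g) = n)
    (hp : ∀ i < n, ∀ g, Halts p c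
      (fun τ => ∃ g', τ.putNat a 0 (τ.nat a 0 + 1) = R (i + 1) g') (R i g)) :
    Halts (Program.forLoop a b p) (n * (c + b.cost + 10) + b.cost + 7)
      (fun τ => ∃ g, τ = R n g) σ := by
  refine Halts.mono_right (m := 3 + (n * ((b.cost + 3) + 1 + (c + 6)) + ((b.cost + 3) + 1)))
    (Halts.seq ?_) (by rw [show b.cost + 3 + 1 + (c + 6) = c + b.cost + 10 by omega]; omega)
  refine ⟨3, _, le_rfl, .setNat σ a (.const 0) (.const 0), ?_⟩
  have := Halts.loop (b := .natLt (.get a (.const 0)) b)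
    (p := .seq p (.setNat a (.const 0) (.add (.get a (.const 0)) (.const 1)))) (n := n)
    (c := c + 6) R h0 ?_ ?_ ?_
  · refine this.mono_right (le_of_eq ?_)
    simp only [Test.cost, NatExp.cost]
    ring
  · intro i hi g
    simpa [Test.holds, NatExp.eval, ha, hb] using hi
  · intro g
    simp [Test.holds, NatExp.eval, ha, hb]
  · intro i hi g
    refine Halts.seq ((hp i hi g).mono ?_ le_rfl)
    rintro τ ⟨g', hg'⟩
    refine ⟨6, _, le_rfl, .setNat τ a (.const 0) _, g', ?_⟩
    simpa [NatExp.eval] using hg'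

/-! ## The memory of the learner -/

/-- The variables of the learner. -/
structure Vars where
  N : ℕ
  k : ℕ
  len : ℕ
  bits : ℕ → ℕ
  K : ℕ
  E : ℕ
  W : ℕ
  tmp : ℕ
  i : ℕ
  j : ℕ
  l : ℕ
  base : ℕ
  row : ℕ
  eps : ℝ
  u : ℕ → ℝ
  wt : ℕ → ℝ
  Lr : ℝ
  Q₁ : ℕ → ℝ
  Q₀ : ℕ → ℝ
  G₁ : ℕ → ℝ
  G₀ : ℕ → ℝ
  s : ℕ → ℝ
  lit : ℕ → ℝ
  S : ℕ → ℝ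
  num : ℝ
  den : ℝ
  phi : ℝ

/-- A sequence with one entry, as array. -/
def cell {α : Type*} [Zero α] (x : α) : ℕ → α := fun q => if q = 0 then x else 0

/-- The layout of the memory. -/
def Vars.mem (r : Vars) : Memory where
  nat a := match a with
    | 0 => fun q => if q = 0 then r.N else if q = 1 then r.k else 0
    | 1 => cell r.len
    | 2 => r.bits
    | 3 => cell r.K
    | 4 => cell r.E
    | 5 => cell r.W
    | 6 => cell r.tmp
    | 7 => cell r.i
    | 8 => cell r.j
    | 9 => cell r.l
    | 10 => cell r.base
    | 11 => cell r.row
    | _ => fun _ => 0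
  real a := match a with
    | 0 => cell r.eps
    | 1 => r.u
    | 2 => r.wt
    | 3 => cell r.Lr
    | 4 => r.Q₁
    | 5 => r.Q₀
    | 6 => r.G₁
    | 7 => r.G₀
    | 8 => r.s
    | 9 => r.lit
    | 10 => r.S
    | 11 => cell r.num
    | 12 => cell r.den
    | 13 => cell r.phi
    | _ => fun _ => 0

theorem update_cell {α : Type*} [Zero α] (x y : α) : Function.update (cell x) 0 y = cell y := by
  funext q
  by_cases h : q = 0 <;> simp [cell, Function.update, h]

/-- Writing a cell amounts to changing one field of `Vars`; this lets `simp` execute programs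
symbolically on the record. -/
theorem Vars.putNat_eq {r r' : Vars} {a i v : ℕ}
    (ha : Function.update (r.mem.nat a) i v = r'.mem.nat a)
    (hne : ∀ b, b ≠ a → r.mem.nat b = r'.mem.nat b) (hr : r.mem.real = r'.mem.real) :
    r.mem.putNat a i v = r'.mem := by
  refine Memory.ext (funext fun b => ?_) hr
  by_cases hb : b = a
  · subst hb
    exact (Function.update_self ..).trans ha
  · exact (Function.update_of_ne hb _ _).trans (hne b hb)

theorem Vars.putReal_eq {r r' : Vars} {a i : ℕ} {v : ℝ}
    (ha : Function.update (r.mem.real a) i v = r'.mem.real a)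
    (hne : ∀ b, b ≠ a → r.mem.real b = r'.mem.real b) (hr : r.mem.nat = r'.mem.nat) :
    r.mem.putReal a i v = r'.mem := by
  refine Memory.ext hr (funext fun b => ?_)
  by_cases hb : b = a
  · subst hb
    exact (Function.update_self ..).trans ha
  · exact (Function.update_of_ne hb _ _).trans (hne b hb)

namespace Vars

variable (r : Vars) (q n : ℕ) (x : ℝ)

@[simp] theorem get_N : r.mem.nat 0 0 = r.N := rfl
@[simp] theorem get_k : r.mem.nat 0 1 = r.k := rfl
@[simp] theorem get_len : r.mem.nat 1 0 = r.len := rfl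
@[simp] theorem get_K : r.mem.nat 3 0 = r.K := rfl
@[simp] theorem get_E : r.mem.nat 4 0 = r.E := rfl
@[simp] theorem get_W : r.mem.nat 5 0 = r.W := rfl
@[simp] theorem get_tmp : r.mem.nat 6 0 = r.tmp := rfl
@[simp] theorem get_i : r.mem.nat 7 0 = r.i := rfl
@[simp] theorem get_j : r.mem.nat 8 0 = r.j := rfl
@[simp] theorem get_l : r.mem.nat 9 0 = r.l := rfl
@[simp] theorem get_base : r.mem.nat 10 0 = r.base := rfl
@[simp] theorem get_row : r.mem.nat 11 0 = r.row := rfl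
@[simp] theorem get_eps : r.mem.real 0 0 = r.eps := rfl
@[simp] theorem get_u : r.mem.real 1 q = r.u q := rfl
@[simp] theorem get_Lr : r.mem.real 3 0 = r.Lr := rfl
@[simp] theorem get_Q₁ : r.mem.real 4 q = r.Q₁ q := rfl
@[simp] theorem get_Q₀ : r.mem.real 5 q = r.Q₀ q := rfl
@[simp] theorem get_G₁ : r.mem.real 6 q = r.G₁ q := rfl
@[simp] theorem get_G₀ : r.mem.real 7 q = r.G₀ q := rfl
@[simp] theorem get_s : r.mem.real 8 q = r.s q := rfl
@[simp] theorem get_lit : r.mem.real 9 q = r.lit q := rfl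
@[simp] theorem get_S : r.mem.real 10 q = r.S q := rfl
@[simp] theorem get_num : r.mem.real 11 0 = r.num := rfl
@[simp] theorem get_den : r.mem.real 12 0 = r.den := rfl
@[simp] theorem get_phi : r.mem.real 13 0 = r.phi := rfl

@[simp] theorem put_len : r.mem.putNat 1 0 n = { r with len := n }.mem :=
  putNat_eq (update_cell _ _) (fun b hb => by
    simp only [mem]; split <;> first | rfl | exact absurd rfl hb) rfl
@[simp] theorem put_bits : r.mem.putNat 2 q n = { r with bits := Function.update r.bits q n }.mem :=
  putNat_eq rfl (fun b hb => by
    simp only [mem]; split <;> first | rfl | exact absurd rfl hb) rfl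
@[simp] theorem put_K : r.mem.putNat 3 0 n = { r with K := n }.mem :=
  putNat_eq (update_cell _ _) (fun b hb => by
    simp only [mem]; split <;> first | rfl | exact absurd rfl hb) rfl
@[simp] theorem put_E : r.mem.putNat 4 0 n = { r with E := n }.mem :=
  putNat_eq (update_cell _ _) (fun b hb => by
    simp only [mem]; split <;> first | rfl | exact absurd rfl hb) rfl
@[simp] theorem put_W : r.mem.putNat 5 0 n = { r with W := n }.mem :=
  putNat_eq (update_cell _ _) (fun b hb => by
    simp only [mem]; split <;> first | rfl | exact absurd rfl hb) rfl
@[simp] theorem put_tmp : r.mem.putNat 6 0 n = { r with tmp := n }.mem :=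
  putNat_eq (update_cell _ _) (fun b hb => by
    simp only [mem]; split <;> first | rfl | exact absurd rfl hb) rfl
@[simp] theorem put_i : r.mem.putNat 7 0 n = { r with i := n }.mem :=
  putNat_eq (update_cell _ _) (fun b hb => by
    simp only [mem]; split <;> first | rfl | exact absurd rfl hb) rfl
@[simp] theorem put_j : r.mem.putNat 8 0 n = { r with j := n }.mem :=
  putNat_eq (update_cell _ _) (fun b hb => by
    simp only [mem]; split <;> first | rfl | exact absurd rfl hb) rfl
@[simp] theorem put_l : r.mem.putNat 9 0 n = { r with l := n }.mem :=
  putNat_eq (update_cell _ _) (fun b hb => by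
    simp only [mem]; split <;> first | rfl | exact absurd rfl hb) rfl
@[simp] theorem put_base : r.mem.putNat 10 0 n = { r with base := n }.mem :=
  putNat_eq (update_cell _ _) (fun b hb => by
    simp only [mem]; split <;> first | rfl | exact absurd rfl hb) rfl
@[simp] theorem put_row : r.mem.putNat 11 0 n = { r with row := n }.mem :=
  putNat_eq (update_cell _ _) (fun b hb => by
    simp only [mem]; split <;> first | rfl | exact absurd rfl hb) rfl
@[simp] theorem put_wt : r.mem.putReal 2 q x = { r with wt := Function.update r.wt q x }.mem :=
  putReal_eq rfl (fun b hb => by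
    simp only [mem]; split <;> first | rfl | exact absurd rfl hb) rfl
@[simp] theorem put_Lr : r.mem.putReal 3 0 x = { r with Lr := x }.mem :=
  putReal_eq (update_cell _ _) (fun b hb => by
    simp only [mem]; split <;> first | rfl | exact absurd rfl hb) rfl
@[simp] theorem put_Q₁ : r.mem.putReal 4 q x = { r with Q₁ := Function.update r.Q₁ q x }.mem :=
  putReal_eq rfl (fun b hb => by
    simp only [mem]; split <;> first | rfl | exact absurd rfl hb) rfl
@[simp] theorem put_Q₀ : r.mem.putReal 5 q x = { r with Q₀ := Function.update r.Q₀ q x }.mem :=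
  putReal_eq rfl (fun b hb => by
    simp only [mem]; split <;> first | rfl | exact absurd rfl hb) rfl
@[simp] theorem put_G₁ : r.mem.putReal 6 q x = { r with G₁ := Function.update r.G₁ q x }.mem :=
  putReal_eq rfl (fun b hb => by
    simp only [mem]; split <;> first | rfl | exact absurd rfl hb) rfl
@[simp] theorem put_G₀ : r.mem.putReal 7 q x = { r with G₀ := Function.update r.G₀ q x }.mem :=
  putReal_eq rfl (fun b hb => by
    simp only [mem]; split <;> first | rfl | exact absurd rfl hb) rfl
@[simp] theorem put_s : r.mem.putReal 8 q x = { r with s := Function.update r.s q x }.mem :=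
  putReal_eq rfl (fun b hb => by
    simp only [mem]; split <;> first | rfl | exact absurd rfl hb) rfl
@[simp] theorem put_lit : r.mem.putReal 9 q x = { r with lit := Function.update r.lit q x }.mem :=
  putReal_eq rfl (fun b hb => by
    simp only [mem]; split <;> first | rfl | exact absurd rfl hb) rfl
@[simp] theorem put_S : r.mem.putReal 10 q x = { r with S := Function.update r.S q x }.mem :=
  putReal_eq rfl (fun b hb => by
    simp only [mem]; split <;> first | rfl | exact absurd rfl hb) rfl
@[simp] theorem put_num : r.mem.putReal 11 0 x = { r with num := x }.mem :=
  putReal_eq (update_cell _ _) (fun b hb => by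
    simp only [mem]; split <;> first | rfl | exact absurd rfl hb) rfl
@[simp] theorem put_den : r.mem.putReal 12 0 x = { r with den := x }.mem :=
  putReal_eq (update_cell _ _) (fun b hb => by
    simp only [mem]; split <;> first | rfl | exact absurd rfl hb) rfl
@[simp] theorem put_phi : r.mem.putReal 13 0 x = { r with phi := x }.mem :=
  putReal_eq (update_cell _ _) (fun b hb => by
    simp only [mem]; split <;> first | rfl | exact absurd rfl hb) rfl

end Vars

attribute [simp] NatExp.eval RealExp.eval Test.holds Program.run Program.straight Program.steps
  NatExp.cost RealExp.cost Test.cost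

/-! ## The program of the learner -/

theorem overwrite_zero (F g : ℕ → ℝ) : overwrite 0 F g = g := by
  funext q
  exact overwrite_of_le (Nat.zero_le q) F g

theorem overwrite_self (n : ℕ) (F g : ℕ → ℝ) : overwrite n F g n = g n :=
  overwrite_of_le le_rfl F g

/-- The invariant of every loop that fills a real array from left to right. -/
theorem update_overwrite {n : ℕ} {F g : ℕ → ℝ} {x : ℝ} (hx : x = F n) :
    Function.update (overwrite n F g) n x = overwrite (n + 1) F g := by
  funext q
  rcases lt_trichotomy q n with h | rfl | h
  · rw [Function.update_of_ne h.ne, overwrite_of_lt h, overwrite_of_lt (by omega)]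
  · rw [Function.update_self, hx, overwrite_of_lt (by omega)]
  · rw [Function.update_of_ne h.ne', overwrite_of_le h.le, overwrite_of_le h]

/-- Compute a product. -/
def mulProgram (x y : NatExp) : Program :=
  .seq (.setNat 6 (.const 0) (.const 0))
    (.forLoop 8 y (.setNat 6 (.const 0) (.add (.get 6 (.const 0)) x)))

theorem halts_mulProgram {x y : NatExp} {r : Vars} {a b : ℕ}
    (hx : ∀ t j, x.eval { r with tmp := t, j := j }.mem = a)
    (hy : ∀ t j, y.eval { r with tmp := t, j := j }.mem = b) :
    Halts (mulProgram x y) (b * (x.cost + y.cost + 20) + y.cost + 10)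
      (fun τ => τ = { r with tmp := b * a, j := b }.mem) r.mem := by
  refine Halts.mono_right (Halts.seq (Halts.run rfl ?_)
    (n := b * (x.cost + 5 + y.cost + 10) + y.cost + 7)) ?_
  · refine Halts.mono (Halts.forLoop (G := Unit) (n := b)
      (fun i _ => { r with tmp := i * a, j := i }.mem) ?_ ?_ ?_ ?_) ?_ le_rfl
    · simp
    · simp
    · intro i _; exact hy _ _
    · intro i _ _
      refine Halts.mono_right (Halts.run rfl ?_) ?_
      · simp [hx, Nat.succ_mul]
      · simp; omega
    · rintro τ ⟨_, rfl⟩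
      rfl
  · simp; ring_nf; omega

/-- Compute the number `W` of conjunctions. -/
def countProgram : Program :=
  -- With truncated subtraction, `k - (k - N) = min k N`.
  .seq (.setNat 3 (.const 0) (.sub (.get 0 (.const 1)) (.sub (.get 0 (.const 1))
      (.get 0 (.const 0))))) <|
  .seq (mulProgram (.get 3 (.const 0)) (.get 3 (.const 0))) <|
  .seq (.setNat 4 (.const 0) (.get 6 (.const 0))) <|
  .seq (mulProgram (.get 4 (.const 0)) (.get 3 (.const 0))) <|
  .seq (.seq (.setNat 4 (.const 0) (.get 6 (.const 0))) (.setNat 5 (.const 0) (.const 1))) <|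
  .forLoop 7 (.get 4 (.const 0)) <|
    -- Multiplication is repeated addition, and its second factor counts the passes: multiplying by
    -- `2 N + 1` thus takes time linear in `N`, not in the current power.
    .seq (mulProgram (.get 5 (.const 0))
      (.add (.get 0 (.const 0)) (.add (.get 0 (.const 0)) (.const 1))))
    (.setNat 5 (.const 0) (.get 6 (.const 0)))

theorem halts_countProgram (r : Vars) :
    Halts countProgram (min r.k r.N * 100 + min r.k r.N ^ 3 * (r.N * 100 + 100) + 100)
      (fun τ => ∃ t i j, τ = { r with
        K := min r.k r.N
        E := min r.k r.N ^ 3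
        W := (2 * r.N + 1) ^ min r.k r.N ^ 3
        tmp := t, i := i, j := j }.mem) r.mem := by
  have hK : r.k - (r.k - r.N) = min r.k r.N := by omega
  set K := min r.k r.N
  refine Halts.mono_right (Halts.seq (Halts.run rfl ?_) (n := (K * 24 + 12) + (5 + ((K * 24 + 12) +
    (8 + (K ^ 3 * (((2 * r.N + 1) * 29 + 30) + 5 + 2 + 10) + 2 + 7)))))) ?_
  · simp only [Program.run, NatExp.eval, Vars.get_N, Vars.get_k, Vars.put_K, hK]
    refine Halts.seq (Halts.mono (halts_mulProgram (a := K) (b := K) ?_ ?_) ?_ ?_)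
    · simp
    · simp
    swap
    · simp
    rintro _ rfl
    refine Halts.seq (Halts.mono_right (Halts.run rfl ?_) (by simp))
    simp only [Program.run, NatExp.eval, Vars.get_tmp, Vars.put_E]
    refine Halts.seq (Halts.mono (halts_mulProgram (a := K * K) (b := K) ?_ ?_) ?_ ?_)
    · simp
    · simp
    swap
    · simp
    rintro _ rfl
    refine Halts.seq (Halts.mono_right (Halts.run rfl ?_) (by simp))
    simp only [Program.run, NatExp.eval, Vars.get_tmp, Vars.put_E, Vars.put_W]
    rw [show K * (K * K) = K ^ 3 by ring]
    refine Halts.mono (Halts.forLoop (G := ℕ × ℕ) (n := K ^ 3) (c := (2 * r.N + 1) * 29 + 30 + 5)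
      (fun i g => { r with
        K := K
        E := K ^ 3
        W := (2 * r.N + 1) ^ i
        tmp := g.1, i := i, j := g.2 }.mem) ?_ ?_ ?_ ?_) ?_ ?_
    · refine ⟨(K ^ 3, K), ?_⟩
      simp
    · simp
    · simp
    · intro i _ g
      refine Halts.seq (Halts.mono (halts_mulProgram (a := (2 * r.N + 1) ^ i)
        (b := 2 * r.N + 1) ?_ ?_) ?_ ?_)
      · simp
      · simp; ring
      swap
      · simp
      rintro _ rfl
      refine Halts.mono_right (Halts.run rfl ?_) (by simp)
      refine ⟨((2 * r.N + 1) * (2 * r.N + 1) ^ i, 2 * r.N + 1), ?_⟩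
      simp [pow_succ']
    · rintro τ ⟨g, rfl⟩
      exact ⟨_, _, _, rfl⟩
    · simp
  · simp; ring_nf; omega

/-- Compute the length of the output. -/
def lengthProgram : Program :=
  .seq (.seq (.setNat 1 (.const 0) (.const 0)) (.setReal 3 (.const 0) (.const 0))) <|
  -- The counter is kept both as a natural and as a real number, since the machine cannot convert
  -- one into the other.
  .loop (.realLt (.mul (.get 3 (.const 0)) (.get 0 (.const 0))) (.const 8)) <|
    .seq (.setNat 1 (.const 0) (.add (.get 1 (.const 0)) (.const 1)))
    (.setReal 3 (.const 0) (.add (.get 3 (.const 0)) (.const 1)))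

theorem halts_lengthProgram (r : Vars) (hε : 0 < r.eps) :
    Halts lengthProgram (⌈8 / r.eps⌉₊ * 30 + 20)
      (fun τ => τ = { r with len := ⌈8 / r.eps⌉₊, Lr := (⌈8 / r.eps⌉₊ : ℝ) }.mem) r.mem := by
  set L := ⌈8 / r.eps⌉₊ with hL
  refine Halts.mono_right (Halts.seq (Halts.run rfl ?_) (n := L * (7 + 1 + 12) + 8)) ?_
  · simp only [Program.run, NatExp.eval, RealExp.eval, Vars.put_len, Vars.put_Lr]
    refine Halts.mono (Halts.loop (G := Unit) (n := L) (c := 12)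
      (fun i _ => { r with len := i, Lr := i }.mem) ?_ ?_ ?_ ?_) ?_ ?_
    · simp
    · intro i hi _
      simp only [Test.holds, RealExp.eval, NatExp.eval, Vars.get_Lr, Vars.get_eps]
      rw [hL, Nat.lt_ceil, lt_div_iff₀ hε] at hi
      exact_mod_cast hi
    · intro _
      simp only [Test.holds, RealExp.eval, NatExp.eval, Vars.get_Lr, Vars.get_eps]
      have := Nat.le_ceil (8 / r.eps)
      rw [← hL, div_le_iff₀ hε] at this
      rw [not_lt]
      exact_mod_cast this
    · intro i _ _
      refine Halts.mono_right (Halts.run rfl ?_) (by simp)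
      simp
    · rintro τ ⟨_, rfl⟩
      rfl
    · simp
  · simp; omega

/-- Update the weights of the specialists for one coordinate, and reset their gains. -/
def updateRowProgram : Program :=
  .forLoop 8 (.get 5 (.const 0)) <|
    .seq (.setReal 4 (.add (.get 10 (.const 0)) (.get 8 (.const 0)))
      (.add (.get 4 (.add (.get 10 (.const 0)) (.get 8 (.const 0))))
        (.mul (.get 1 (.get 7 (.const 0)))
          (.get 6 (.add (.get 10 (.const 0)) (.get 8 (.const 0))))))) <|
    .seq (.cond (.realLt (.get 4 (.add (.get 10 (.const 0)) (.get 8 (.const 0)))) (.const 0))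
      (.setReal 4 (.add (.get 10 (.const 0)) (.get 8 (.const 0))) (.const 0)) .nop) <|
    .seq (.setReal 5 (.add (.get 10 (.const 0)) (.get 8 (.const 0)))
      (.add (.get 5 (.add (.get 10 (.const 0)) (.get 8 (.const 0))))
        (.mul (.get 1 (.get 7 (.const 0)))
          (.get 7 (.add (.get 10 (.const 0)) (.get 8 (.const 0))))))) <|
    .seq (.cond (.realLt (.get 5 (.add (.get 10 (.const 0)) (.get 8 (.const 0)))) (.const 0))
      (.setReal 5 (.add (.get 10 (.const 0)) (.get 8 (.const 0))) (.const 0)) .nop) <|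
    .seq (.setReal 6 (.add (.get 10 (.const 0)) (.get 8 (.const 0))) (.const 0))
      (.setReal 7 (.add (.get 10 (.const 0)) (.get 8 (.const 0))) (.const 0))

theorem halts_updateRowProgram (r : Vars) {W : ℕ} (hW : r.W = W) {F₁ F₀ Q₁ Q₀ G₁ G₀ : ℕ → ℝ}
    (h₁ : ∀ j < W, F₁ (r.base + j) = max (Q₁ (r.base + j) + r.u r.i * G₁ (r.base + j)) 0)
    (h₀ : ∀ j < W, F₀ (r.base + j) = max (Q₀ (r.base + j) + r.u r.i * G₀ (r.base + j)) 0) :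
    Halts updateRowProgram (W * 200 + 20)
      (fun τ => τ = { r with
        j := W
        Q₁ := overwrite (r.base + W) F₁ Q₁
        Q₀ := overwrite (r.base + W) F₀ Q₀
        G₁ := overwrite (r.base + W) 0 G₁
        G₀ := overwrite (r.base + W) 0 G₀ }.mem)
      { r with
        Q₁ := overwrite r.base F₁ Q₁
        Q₀ := overwrite r.base F₀ Q₀
        G₁ := overwrite r.base 0 G₁
        G₀ := overwrite r.base 0 G₀ }.mem := by
  refine Halts.mono (Halts.forLoop (G := Unit) (n := W) (c := 150)
    (fun j _ => { r with
        j := j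
        Q₁ := overwrite (r.base + j) F₁ Q₁
        Q₀ := overwrite (r.base + j) F₀ Q₀
        G₁ := overwrite (r.base + j) 0 G₁
        G₀ := overwrite (r.base + j) 0 G₀ }.mem) ?_ ?_ ?_ ?_) ?_ ?_
  · simp
  · simp
  · simp [hW]
  · intro j hj _
    refine Halts.mono_right (Halts.run rfl ⟨(), ?_⟩) (by simp)
    have e₁ := h₁ j hj
    have e₀ := h₀ j hj
    by_cases c₁ : Q₁ (r.base + j) + r.u r.i * G₁ (r.base + j) < 0 <;>
    by_cases c₀ : Q₀ (r.base + j) + r.u r.i * G₀ (r.base + j) < 0 <;>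
    · first
      | rw [max_eq_right c₁.le] at e₁
      | rw [max_eq_left (not_lt.mp c₁)] at e₁
      first
      | rw [max_eq_right c₀.le] at e₀
      | rw [max_eq_left (not_lt.mp c₀)] at e₀
      simp [overwrite_self, c₁, c₀]
      congr 2 <;> first | exact update_overwrite e₁.symm | exact update_overwrite e₀.symm |
        exact update_overwrite rfl
  · rintro τ ⟨_, rfl⟩
    rfl
  · simp; omega

/-- Update the weights of the specialists. -/
def updateProgram : Program :=
  .seq (.setNat 10 (.const 0) (.const 0)) <|
  .forLoop 7 (.get 0 (.const 0)) <|
    .seq updateRowProgram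
      (.setNat 10 (.const 0) (.add (.get 10 (.const 0)) (.get 5 (.const 0))))

theorem halts_updateProgram (r : Vars) :
    Halts updateProgram (r.N * (r.W * 200 + 50) + 20)
      (fun τ => ∃ i j b, τ = { r with
        i := i
        j := j
        base := b
        Q₁ := LearnerState.accumulate r.N r.W r.u r.G₁ r.Q₁
        Q₀ := LearnerState.accumulate r.N r.W r.u r.G₀ r.Q₀
        G₁ := overwrite (r.N * r.W) 0 r.G₁
        G₀ := overwrite (r.N * r.W) 0 r.G₀ }.mem) r.mem := by
  refine Halts.mono_right (Halts.seq (Halts.run rfl ?_)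
    (n := r.N * ((r.W * 200 + 27) + 2 + 10) + 2 + 7)) ?_
  · refine Halts.mono (Halts.forLoop (G := ℕ) (n := r.N) (c := r.W * 200 + 27)
      (fun i g => { r with
        i := i
        j := g
        base := i * r.W
        Q₁ := overwrite (i * r.W) (fun q => max (r.Q₁ q + r.u (q / r.W) * r.G₁ q) 0) r.Q₁
        Q₀ := overwrite (i * r.W) (fun q => max (r.Q₀ q + r.u (q / r.W) * r.G₀ q) 0) r.Q₀
        G₁ := overwrite (i * r.W) 0 r.G₁
        G₀ := overwrite (i * r.W) 0 r.G₀ }.mem) ?_ ?_ ?_ ?_) ?_ ?_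
    · refine ⟨r.j, ?_⟩
      simp [overwrite_zero]
    · simp
    · simp
    · intro i hi g
      refine Halts.seq (m := r.W * 200 + 20) (n := 7) (Halts.mono (halts_updateRowProgram
        { r with i := i, j := g, base := i * r.W } (W := r.W) rfl
        (F₁ := fun q => max (r.Q₁ q + r.u (q / r.W) * r.G₁ q) 0)
        (F₀ := fun q => max (r.Q₀ q + r.u (q / r.W) * r.G₀ q) 0)
        (Q₁ := r.Q₁) (Q₀ := r.Q₀) (G₁ := r.G₁) (G₀ := r.G₀) ?_ ?_) ?_ le_rfl)
      · intro j hj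
        simp only [index_div hj]
      · intro j hj
        simp only [index_div hj]
      · rintro _ rfl
        refine Halts.mono_right (Halts.run rfl ⟨r.W, ?_⟩) (show _ ≤ 7 by simp)
        simp [Nat.succ_mul]
    · rintro τ ⟨g, rfl⟩
      exact ⟨_, _, _, rfl⟩
    · simp
  · simp; ring_nf; omega

/-- Round the discrepancy, and write the resulting point into the output. -/
def roundProgram : Program :=
  .forLoop 7 (.get 0 (.const 0)) <|
    .cond (.realLt (.const 0) (.get 8 (.get 7 (.const 0))))
      (.seq (.setNat 2 (.add (.get 11 (.const 0)) (.get 7 (.const 0))) (.const 1))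
        (.seq (.setReal 9 (.add (.get 7 (.const 0)) (.get 7 (.const 0))) (.const 1))
          (.setReal 9 (.add (.add (.get 7 (.const 0)) (.get 7 (.const 0))) (.const 1))
            (.const 0))))
      (.seq (.setNat 2 (.add (.get 11 (.const 0)) (.get 7 (.const 0))) (.const 0))
        (.seq (.setReal 9 (.add (.get 7 (.const 0)) (.get 7 (.const 0))) (.const 0))
          (.setReal 9 (.add (.add (.get 7 (.const 0)) (.get 7 (.const 0))) (.const 1))
            (.const 1))))

/-- Overwrite the first `n` entries of a sequence of natural numbers. -/
def overwriteNat (n : ℕ) (F g : ℕ → ℕ) : ℕ → ℕ := fun q => if q < n then F q else g q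

theorem update_overwriteNat {n : ℕ} {F g : ℕ → ℕ} {x : ℕ} (hx : x = F n) :
    Function.update (overwriteNat n F g) n x = overwriteNat (n + 1) F g := by
  funext q
  rcases lt_trichotomy q n with h | rfl | h
  · rw [Function.update_of_ne h.ne]
    simp [overwriteNat, h, h.trans n.lt_succ_self]
  · simp [overwriteNat, hx]
  · rw [Function.update_of_ne h.ne']
    simp [overwriteNat, h.not_gt, (show ¬ q < n + 1 by omega)]

theorem halts_roundProgram (r : Vars) {N : ℕ} (hN : r.N = N) {F B : ℕ → ℕ}
    (hF : ∀ i < N, F (r.row + i) = if roundUp r.s i then 1 else 0) :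
    Halts roundProgram (N * 100 + 20)
      (fun τ => τ = { r with
        i := N
        bits := overwriteNat (r.row + N) F B
        lit := overwrite (2 * N) (literal (roundUp r.s)) r.lit }.mem)
      { r with bits := overwriteNat r.row F B }.mem := by
  refine Halts.mono (Halts.forLoop (G := Unit) (n := N) (c := 80)
    (fun i _ => { r with
        i := i
        bits := overwriteNat (r.row + i) F B
        lit := overwrite (2 * i) (literal (roundUp r.s)) r.lit }.mem) ?_ ?_ ?_ ?_) ?_ ?_
  · simp [overwrite_zero]
  · simp
  · simp [hN]
  · intro i hi _
    refine Halts.mono_right (Halts.run rfl ⟨(), ?_⟩) (by simp)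
    have e := hF i hi
    have l₂ : (2 * i + 1) / 2 = i := by omega
    by_cases h : 0 < r.s i
    · have hr : roundUp r.s i = true := by simp [roundUp, h]
      rw [hr, if_pos rfl] at e
      have l₀ : (1 : ℝ) = literal (roundUp r.s) (2 * i) := by simp [literal, hr]
      have l₁ : (0 : ℝ) = literal (roundUp r.s) (2 * i + 1) := by simp [literal, hr, l₂]
      simp [h, ← two_mul]
      congr 2
      · exact update_overwriteNat e.symm
      · rw [update_overwrite l₀, update_overwrite l₁]
        rfl
    · have hr : roundUp r.s i = false := by simp [roundUp, h]
      rw [hr] at e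
      have l₀ : (0 : ℝ) = literal (roundUp r.s) (2 * i) := by simp [literal, hr]
      have l₁ : (1 : ℝ) = literal (roundUp r.s) (2 * i + 1) := by simp [literal, hr, l₂]
      simp [h, ← two_mul]
      congr 2
      · exact update_overwriteNat e.symm
      · rw [update_overwrite l₀, update_overwrite l₁]
        rfl
  · rintro τ ⟨_, rfl⟩
    rfl
  · simp; omega

/-- Evaluate the conjunctions. -/
def featureProgram : Program :=
  .seq (.seq (.setReal 10 (.const 0) (.const 1)) (.setNat 10 (.const 0) (.const 1))) <|
  .forLoop 7 (.get 5 (.const 0)) <|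
    .seq (.forLoop 8 (.add (.get 0 (.const 0)) (.get 0 (.const 0)))
      (.setReal 10 (.add (.get 10 (.const 0)) (.get 8 (.const 0)))
        (.mul (.get 10 (.get 7 (.const 0))) (.get 9 (.get 8 (.const 0))))))
    (.setNat 10 (.const 0) (.add (.get 10 (.const 0))
      (.add (.get 0 (.const 0)) (.get 0 (.const 0)))))

theorem halts_featureProgram (r : Vars) (hN : 0 < r.N) {y : ℕ → Bool}
    (hlit : ∀ j < 2 * r.N, r.lit j = literal y j) :
    Halts featureProgram (r.W * (r.N * 100 + 50) + 20)
      (fun τ => ∃ i j b, τ = { r with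
        i := i
        j := j
        base := b
        S := overwrite (2 * r.N * r.W + 1) (feature r.N y) r.S }.mem) r.mem := by
  refine Halts.mono_right (Halts.seq (Halts.run rfl ?_)
    (n := r.W * ((2 * r.N * 35 + 30) + 2 + 10) + 2 + 7)) ?_
  · refine Halts.mono (Halts.forLoop (G := ℕ) (n := r.W) (c := 2 * r.N * 35 + 30)
      (fun i g => { r with
        i := i
        j := g
        base := 2 * r.N * i + 1
        S := overwrite (2 * r.N * i + 1) (feature r.N y) r.S }.mem) ?_ ?_ ?_ ?_) ?_ ?_
    · refine ⟨r.j, ?_⟩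
      simp
      congr 2
      have := update_overwrite (n := 0) (F := feature r.N y) (g := r.S) (x := 1)
        (by rw [feature])
      rwa [overwrite_zero] at this
    · simp
    · simp
    · intro i hi g
      refine Halts.mono_right (Halts.seq (m := 2 * r.N * (13 + 5 + 10) + 5 + 7) (n := 10)
        (Halts.mono (Halts.forLoop (G := Unit) (n := 2 * r.N) (c := 13)
        (fun j _ => { r with
          i := i
          j := j
          base := 2 * r.N * i + 1
          S := overwrite (2 * r.N * i + 1 + j) (feature r.N y) r.S }.mem) ?_ ?_ ?_ ?_) ?_ ?_)) ?_
      · simp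
      · simp
      · simp [two_mul]
      · intro j hj _
        refine Halts.mono_right (Halts.run rfl ⟨(), ?_⟩) (by simp)
        -- A child has a larger index than its parent, so the value of the parent is already in the
        -- array.
        have hlt : i < 2 * r.N * i + 1 + j := by nlinarith
        simp [overwrite_of_lt hlt, hlit j hj]
        congr 2
        refine update_overwrite ?_
        rw [← feature_child y i hj]
        congr 1
        ring
      · rintro τ ⟨_, rfl⟩
        refine Halts.mono_right (Halts.run rfl ⟨2 * r.N, ?_⟩) (by simp)
        have e : 2 * r.N * i + 1 + 2 * r.N = 2 * r.N * (i + 1) + 1 := by ring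
        simp [← two_mul, e]
      · simp
      · omega
    · rintro τ ⟨g, rfl⟩
      exact ⟨_, _, _, rfl⟩
    · simp
  · simp; ring_nf; omega

/-- Compute the total weights of the specialists that are awake, for one coordinate. -/
def sumProgram : Program :=
  .seq (.seq (.setReal 11 (.const 0) (.const 0)) (.setReal 12 (.const 0) (.const 0))) <|
  .forLoop 8 (.get 5 (.const 0)) <|
    .seq (.setReal 11 (.const 0) (.add (.get 11 (.const 0)) (.mul (.get 10 (.get 8 (.const 0)))
      (.get 4 (.add (.get 10 (.const 0)) (.get 8 (.const 0)))))))
    (.setReal 12 (.const 0) (.add (.get 12 (.const 0)) (.mul (.get 10 (.get 8 (.const 0)))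
      (.get 5 (.add (.get 10 (.const 0)) (.get 8 (.const 0)))))))

theorem halts_sumProgram (r : Vars) :
    Halts sumProgram (r.W * 100 + 20)
      (fun τ => τ = { r with
        j := r.W
        num := ∑ c ∈ Finset.range r.W, r.S c * r.Q₁ (r.base + c)
        den := ∑ c ∈ Finset.range r.W, r.S c * r.Q₀ (r.base + c) }.mem) r.mem := by
  refine Halts.mono_right (Halts.seq (Halts.run rfl ?_)
    (n := r.W * (50 + 2 + 10) + 2 + 7)) ?_
  · refine Halts.mono (Halts.forLoop (G := Unit) (n := r.W) (c := 50)
      (fun j _ => { r with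
        j := j
        num := ∑ c ∈ Finset.range j, r.S c * r.Q₁ (r.base + c)
        den := ∑ c ∈ Finset.range j, r.S c * r.Q₀ (r.base + c) }.mem) ?_ ?_ ?_ ?_) ?_ ?_
    · simp
    · simp
    · simp
    · intro j hj _
      refine Halts.mono_right (Halts.run rfl ⟨(), ?_⟩) (by simp)
      simp [Finset.sum_range_succ]
    · rintro τ ⟨_, rfl⟩
      rfl
    · simp
  · simp; omega

/-- Add to the gains of the specialists for one coordinate. -/
def gainRowProgram : Program :=
  .forLoop 8 (.get 5 (.const 0)) <|
    .seq (.setReal 6 (.add (.get 10 (.const 0)) (.get 8 (.const 0)))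
      (.add (.get 6 (.add (.get 10 (.const 0)) (.get 8 (.const 0))))
        (.mul (.get 10 (.get 8 (.const 0)))
          (.div (.sub (.const 1) (.get 13 (.const 0))) (.get 3 (.const 0))))))
    (.setReal 7 (.add (.get 10 (.const 0)) (.get 8 (.const 0)))
      (.add (.get 7 (.add (.get 10 (.const 0)) (.get 8 (.const 0))))
        (.mul (.get 10 (.get 8 (.const 0)))
          (.div (.sub (.const 0) (.get 13 (.const 0))) (.get 3 (.const 0))))))

theorem halts_gainRowProgram (r : Vars) {W : ℕ} (hW : r.W = W) {F₁ F₀ G₁ G₀ : ℕ → ℝ}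
    (h₁ : ∀ j < W, F₁ (r.base + j) = G₁ (r.base + j) + r.S j * ((1 - r.phi) / r.Lr))
    (h₀ : ∀ j < W, F₀ (r.base + j) = G₀ (r.base + j) + r.S j * ((0 - r.phi) / r.Lr)) :
    Halts gainRowProgram (W * 100 + 20)
      (fun τ => τ = { r with
        j := W
        G₁ := overwrite (r.base + W) F₁ G₁
        G₀ := overwrite (r.base + W) F₀ G₀ }.mem)
      { r with
        G₁ := overwrite r.base F₁ G₁
        G₀ := overwrite r.base F₀ G₀ }.mem := by
  refine Halts.mono (Halts.forLoop (G := Unit) (n := W) (c := 80)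
    (fun j _ => { r with
        j := j
        G₁ := overwrite (r.base + j) F₁ G₁
        G₀ := overwrite (r.base + j) F₀ G₀ }.mem) ?_ ?_ ?_ ?_) ?_ ?_
  · simp
  · simp
  · simp [hW]
  · intro j hj _
    refine Halts.mono_right (Halts.run rfl ⟨(), ?_⟩) (by simp)
    have e₁ := (h₁ j hj).symm
    have e₀ := (h₀ j hj).symm
    simp only [Program.run, NatExp.eval, RealExp.eval, Vars.get_base, Vars.get_j, Vars.get_S,
      Vars.get_phi, Vars.get_Lr, Vars.get_G₁, Vars.get_G₀, Vars.put_G₁, Vars.put_G₀,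
      Vars.put_j, overwrite_self, Rat.cast_one, Rat.cast_zero, update_overwrite e₁,
      update_overwrite e₀]
    rfl
  · rintro τ ⟨_, rfl⟩
    rfl
  · simp; omega

/-- Predict all coordinates, and update the gains and the discrepancy. -/
def predictProgram : Program :=
  .seq (.setNat 10 (.const 0) (.const 0)) <|
  .forLoop 7 (.get 0 (.const 0)) <|
    .seq sumProgram <|
    .seq (.setReal 13 (.const 0) (.div (.get 11 (.const 0))
      (.add (.get 11 (.const 0)) (.get 12 (.const 0))))) <|
    .seq gainRowProgram <|
    -- The literal `2 i` supplies the played bit as a real number.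
    .seq (.setReal 8 (.get 7 (.const 0)) (.add (.get 8 (.get 7 (.const 0)))
      (.sub (.get 13 (.const 0)) (.get 9 (.add (.get 7 (.const 0)) (.get 7 (.const 0)))))))
    (.setNat 10 (.const 0) (.add (.get 10 (.const 0)) (.get 5 (.const 0))))

theorem halts_predictProgram (r : Vars) (hlit : ∀ j < 2 * r.N, r.lit j = literal (roundUp r.s) j)
    (hS : ∀ c < r.W, r.S c = feature r.N (roundUp r.s) c) :
    Halts predictProgram (r.N * (r.W * 200 + 100) + 20)
      (fun τ => ∃ i j b x y z, τ = { r with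
        i := i
        j := j
        base := b
        num := x
        den := y
        phi := z
        s := stepDiscrepancy r.N r.W r.Q₁ r.Q₀ r.s
        G₁ := overwrite (r.N * r.W) (fun q => r.G₁ q + feature r.N (roundUp r.s) (q % r.W) *
          ((1 - predict r.N r.W r.Q₁ r.Q₀ (roundUp r.s) (q / r.W)) / r.Lr)) r.G₁
        G₀ := overwrite (r.N * r.W) (fun q => r.G₀ q + feature r.N (roundUp r.s) (q % r.W) *
          ((0 - predict r.N r.W r.Q₁ r.Q₀ (roundUp r.s) (q / r.W)) / r.Lr)) r.G₀ }.mem)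
      r.mem := by
  set F₁ : ℕ → ℝ := fun q => r.G₁ q + feature r.N (roundUp r.s) (q % r.W) *
    ((1 - predict r.N r.W r.Q₁ r.Q₀ (roundUp r.s) (q / r.W)) / r.Lr) with hF₁
  set F₀ : ℕ → ℝ := fun q => r.G₀ q + feature r.N (roundUp r.s) (q % r.W) *
    ((0 - predict r.N r.W r.Q₁ r.Q₀ (roundUp r.s) (q / r.W)) / r.Lr) with hF₀
  set Fs : ℕ → ℝ := fun i => r.s i + (predict r.N r.W r.Q₁ r.Q₀ (roundUp r.s) i -
    if roundUp r.s i then 1 else 0) with hFs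
  refine Halts.mono_right (Halts.seq (Halts.run rfl ?_)
    (n := r.N * (((r.W * 100 + 20) + (10 + ((r.W * 100 + 20) + 30))) + 2 + 10) + 2 + 7)) ?_
  · refine Halts.mono (Halts.forLoop (G := ℕ × ℝ × ℝ × ℝ) (n := r.N)
      (c := (r.W * 100 + 20) + (10 + ((r.W * 100 + 20) + 30)))
      (fun i g => { r with
        i := i
        j := g.1
        base := i * r.W
        num := g.2.1
        den := g.2.2.1
        phi := g.2.2.2
        s := overwrite i Fs r.s
        G₁ := overwrite (i * r.W) F₁ r.G₁
        G₀ := overwrite (i * r.W) F₀ r.G₀ }.mem) ?_ ?_ ?_ ?_) ?_ ?_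
    · refine ⟨(r.j, r.num, r.den, r.phi), ?_⟩
      simp [overwrite_zero]
    · simp
    · simp
    · intro i hi g
      have hsum : ∀ Q : ℕ → ℝ, ∑ c ∈ Finset.range r.W, r.S c * Q (i * r.W + c) =
          awakeWeight r.N r.W Q (roundUp r.s) i := fun Q =>
        Finset.sum_congr rfl fun c hc => by rw [hS c (Finset.mem_range.mp hc)]
      refine Halts.seq (Halts.mono (halts_sumProgram _) ?_ le_rfl)
      rintro _ rfl
      simp only [hsum]
      refine Halts.seq (Halts.mono_right (Halts.run rfl ?_) (by simp))
      simp only [Program.run, NatExp.eval, RealExp.eval, Vars.get_num, Vars.get_den, Vars.put_phi]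
      have hp : awakeWeight r.N r.W r.Q₁ (roundUp r.s) i / (awakeWeight r.N r.W r.Q₁ (roundUp r.s) i
          + awakeWeight r.N r.W r.Q₀ (roundUp r.s) i) =
          predict r.N r.W r.Q₁ r.Q₀ (roundUp r.s) i := rfl
      rw [hp]
      refine Halts.seq (Halts.mono (halts_gainRowProgram
        { r with
          i := i
          j := r.W
          base := i * r.W
          num := awakeWeight r.N r.W r.Q₁ (roundUp r.s) i
          den := awakeWeight r.N r.W r.Q₀ (roundUp r.s) i
          phi := predict r.N r.W r.Q₁ r.Q₀ (roundUp r.s) i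
          s := overwrite i Fs r.s } (W := r.W) rfl (F₁ := F₁) (F₀ := F₀) (G₁ := r.G₁) (G₀ := r.G₀)
          ?_ ?_) ?_ le_rfl)
      · intro j hj
        simp only [hF₁, index_div hj, index_mod hj, hS j hj]
      · intro j hj
        simp only [hF₀, index_div hj, index_mod hj, hS j hj]
      · rintro _ rfl
        refine Halts.mono_right (Halts.run rfl ⟨(r.W,
          awakeWeight r.N r.W r.Q₁ (roundUp r.s) i, awakeWeight r.N r.W r.Q₀ (roundUp r.s) i,
          predict r.N r.W r.Q₁ r.Q₀ (roundUp r.s) i), ?_⟩) (by simp)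
        have hl : r.lit (i + i) = if roundUp r.s i then 1 else 0 := by
          rw [hlit _ (by omega), ← two_mul]
          simp [literal]
        simp only [Program.run, NatExp.eval, RealExp.eval, Vars.get_i, Vars.get_s, Vars.get_phi,
          Vars.get_lit, Vars.put_s, Vars.get_base, Vars.get_W, Vars.put_base, Vars.put_i, hl,
          overwrite_self]
        rw [update_overwrite (F := Fs) (by rw [hFs]), Nat.succ_mul]
    · rintro τ ⟨g, rfl⟩
      exact ⟨_, _, _, _, _, _, rfl⟩
    · simp
  · simp; ring_nf; omega

/-- Play one round. -/
def playProgram : Program :=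
  .seq (.setNat 11 (.const 0) (.const 0)) <|
  .forLoop 9 (.get 1 (.const 0)) <|
    .seq (.setReal 2 (.get 9 (.const 0)) (.div (.const 1) (.get 3 (.const 0)))) <|
    .seq roundProgram <|
    .seq (.setNat 11 (.const 0) (.add (.get 11 (.const 0)) (.get 0 (.const 0)))) <|
    .seq featureProgram predictProgram

theorem gain_zero (N W L : ℕ) (b : ℝ) (Q₁ Q₀ s : ℕ → ℝ) : gain N W L b Q₁ Q₀ s 0 = 0 := by
  funext q
  simp [gain]

/-- One more played point adds one more term to the gains. -/
theorem overwrite_gain_succ (N W L : ℕ) (b : ℝ) (Q₁ Q₀ s G : ℕ → ℝ) (l : ℕ) :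
    overwrite (N * W) (fun q => overwrite (N * W) (gain N W L b Q₁ Q₀ s l) G q +
      feature N (roundUp (discrepancy N W Q₁ Q₀ s l)) (q % W) *
        ((b - predict N W Q₁ Q₀ (roundUp (discrepancy N W Q₁ Q₀ s l)) (q / W)) / L))
      (overwrite (N * W) (gain N W L b Q₁ Q₀ s l) G) =
    overwrite (N * W) (gain N W L b Q₁ Q₀ s (l + 1)) G := by
  funext q
  rcases lt_or_ge q (N * W) with h | h
  · rw [overwrite_of_lt h, overwrite_of_lt h, overwrite_of_lt h, gain, gain,
      Finset.sum_range_succ]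
    rfl
  · rw [overwrite_of_le h, overwrite_of_le h, overwrite_of_le h]

theorem halts_playProgram (r : Vars) (hN : 0 < r.N) (hL : r.Lr = r.len) :
    Halts playProgram
      (r.len * ((r.N * 100 + 20) + (r.W * (r.N * 100 + 50) + 20) +
        (r.N * (r.W * 200 + 100) + 20) + 50) + 20)
      (fun τ => ∃ i j l b w x y z a c, τ = { r with
        i := i
        j := j
        l := l
        base := b
        row := w
        num := x
        den := y
        phi := z
        lit := a
        S := c
        Lr := r.len
        wt := overwrite r.len (fun _ => 1 / r.len) r.wt
        bits := overwriteNat (r.len * r.N) (fun q =>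
          if played r.N r.W r.Q₁ r.Q₀ r.s (q / r.N) (q % r.N) then 1 else 0) r.bits
        s := discrepancy r.N r.W r.Q₁ r.Q₀ r.s r.len
        G₁ := overwrite (r.N * r.W) (gain r.N r.W r.len 1 r.Q₁ r.Q₀ r.s r.len) r.G₁
        G₀ := overwrite (r.N * r.W) (gain r.N r.W r.len 0 r.Q₁ r.Q₀ r.s r.len) r.G₀ }.mem)
      { r with
        G₁ := overwrite (r.N * r.W) 0 r.G₁
        G₀ := overwrite (r.N * r.W) 0 r.G₀ }.mem := by
  set B : ℕ → ℕ := fun q =>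
    if played r.N r.W r.Q₁ r.Q₀ r.s (q / r.N) (q % r.N) then 1 else 0 with hB
  refine Halts.mono_right (Halts.seq (Halts.run rfl ?_)
    (n := r.len * ((10 + ((r.N * 100 + 20) + (10 + ((r.W * (r.N * 100 + 50) + 20) +
        (r.N * (r.W * 200 + 100) + 20))))) + 2 + 10) + 2 + 7)) ?_
  · refine Halts.mono (Halts.forLoop (G := ℕ × ℕ × ℕ × ℝ × ℝ × ℝ × (ℕ → ℝ) × (ℕ → ℝ))
      (n := r.len)
      (fun l g => { r with
        i := g.1
        j := g.2.1
        l := l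
        base := g.2.2.1
        row := l * r.N
        num := g.2.2.2.1
        den := g.2.2.2.2.1
        phi := g.2.2.2.2.2.1
        lit := g.2.2.2.2.2.2.1
        S := g.2.2.2.2.2.2.2
        Lr := r.len
        wt := overwrite l (fun _ => 1 / r.len) r.wt
        bits := overwriteNat (l * r.N) B r.bits
        s := discrepancy r.N r.W r.Q₁ r.Q₀ r.s l
        G₁ := overwrite (r.N * r.W) (gain r.N r.W r.len 1 r.Q₁ r.Q₀ r.s l) r.G₁
        G₀ := overwrite (r.N * r.W) (gain r.N r.W r.len 0 r.Q₁ r.Q₀ r.s l) r.G₀ }.mem)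
      ?_ ?_ ?_ ?_) ?_ le_rfl
    · refine ⟨(r.i, r.j, r.base, r.num, r.den, r.phi, r.lit, r.S), ?_⟩
      have h0 : overwriteNat 0 B r.bits = r.bits := rfl
      have h1 : discrepancy r.N r.W r.Q₁ r.Q₀ r.s 0 = r.s := rfl
      simp [overwrite_zero, gain_zero, h0, h1, hL]
    · simp
    · simp
    · intro l hl g
      refine Halts.seq (Halts.mono_right (Halts.run rfl ?_) (by simp))
      simp only [Program.run, NatExp.eval, RealExp.eval, Vars.get_l, Vars.get_Lr, Vars.put_wt,
        Rat.cast_one]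
      rw [update_overwrite rfl]
      refine Halts.seq (Halts.mono (halts_roundProgram
        { r with
          i := g.1
          j := g.2.1
          l := l
          base := g.2.2.1
          row := l * r.N
          num := g.2.2.2.1
          den := g.2.2.2.2.1
          phi := g.2.2.2.2.2.1
          lit := g.2.2.2.2.2.2.1
          S := g.2.2.2.2.2.2.2
          Lr := r.len
          wt := overwrite (l + 1) (fun _ => 1 / r.len) r.wt
          s := discrepancy r.N r.W r.Q₁ r.Q₀ r.s l
          G₁ := overwrite (r.N * r.W) (gain r.N r.W r.len 1 r.Q₁ r.Q₀ r.s l) r.G₁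
          G₀ := overwrite (r.N * r.W) (gain r.N r.W r.len 0 r.Q₁ r.Q₀ r.s l) r.G₀ }
        (N := r.N) rfl (F := B) (B := r.bits) ?_) ?_ le_rfl)
      · intro i hi
        simp only [hB, index_div hi, index_mod hi]
        rfl
      rintro _ rfl
      refine Halts.seq (Halts.mono_right (Halts.run rfl ?_) (by simp))
      simp only [Program.run, NatExp.eval, Vars.get_row, Vars.get_N, Vars.put_row]
      refine Halts.seq (Halts.mono (halts_featureProgram _ (by exact hN)
        (y := roundUp (discrepancy r.N r.W r.Q₁ r.Q₀ r.s l))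
        (by exact fun j hj => overwrite_of_lt hj _ _)) ?_ le_rfl)
      rintro _ ⟨i, j, b, rfl⟩
      refine Halts.mono (halts_predictProgram _ (fun j hj => overwrite_of_lt hj _ _)
        fun c hc => overwrite_of_lt (lt_of_lt_of_le hc ?_) _ _) ?_ le_rfl
      -- The children of all `W` nodes are evaluated, which covers more than the first `W`
      -- conjunctions.
      · exact (Nat.le_mul_of_pos_left _ (Nat.mul_pos two_pos hN)).trans (Nat.le_succ _)
      · rintro _ ⟨i, j, b, x, y, z, rfl⟩
        refine ⟨(i, j, b, x, y, z, overwrite (2 * r.N)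
          (literal (roundUp (discrepancy r.N r.W r.Q₁ r.Q₀ r.s l))) g.2.2.2.2.2.2.1,
          overwrite (2 * r.N * r.W + 1)
            (feature r.N (roundUp (discrepancy r.N r.W r.Q₁ r.Q₀ r.s l))) g.2.2.2.2.2.2.2), ?_⟩
        simp only [Vars.get_l, Vars.put_l, overwrite_gain_succ, discrepancy_succ, Nat.succ_mul]
    · rintro τ ⟨g, rfl⟩
      exact ⟨_, _, _, _, _, _, _, _, _, _, rfl⟩
  · simp; ring_nf; omega

/-- The program of the learner. -/
def nextProgram : Program :=
  .seq countProgram <| .seq lengthProgram <| .seq updateProgram playProgram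

def Vars.state (r : Vars) : LearnerState := ⟨r.Q₁, r.Q₀, r.G₁, r.G₀, r.s⟩

/-- One run of the program carries out `LearnerState.round` on the fields that represent the state.
The played points come from the updated weights and the old discrepancy `r.s`. -/
theorem halts_nextProgram (r : Vars) {W L : ℕ} (hN : 0 < r.N) (hε : 0 < r.eps)
    (hW : (2 * r.N + 1) ^ min r.k r.N ^ 3 = W) (hL : ⌈8 / r.eps⌉₊ = L) :
    Halts nextProgram ((min r.k r.N * 100 + min r.k r.N ^ 3 * (r.N * 100 + 100) + 100) +
        ((L * 30 + 20) + ((r.N * (W * 200 + 50) + 20) +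
      (L * ((r.N * 100 + 20) + (W * (r.N * 100 + 50) + 20) +
        (r.N * (W * 200 + 100) + 20) + 50) + 20))))
      (fun τ => ∃ r' : Vars, τ = r'.mem ∧ r'.N = r.N ∧ r'.k = r.k ∧ r'.eps = r.eps ∧
        r'.u = r.u ∧ r'.len = L ∧ r'.state = LearnerState.round r.N W L r.u r.state ∧
        (∀ l < L, r'.wt l = 1 / L) ∧
        ∀ l < L, ∀ i < r.N, r'.bits (l * r.N + i) =
          if played r.N W r'.Q₁ r'.Q₀ r.s l i then 1 else 0) r.mem := by
  refine Halts.seq (Halts.mono (halts_countProgram r) ?_ le_rfl)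
  rintro _ ⟨t, i, j, rfl⟩
  rw [hW]
  refine Halts.seq (Halts.mono (halts_lengthProgram _ hε) ?_ (by simp only [hL]; exact le_rfl))
  rintro _ rfl
  simp only [hL]
  refine Halts.seq (Halts.mono (halts_updateProgram _) ?_ le_rfl)
  rintro _ ⟨i, j, b, rfl⟩
  refine Halts.mono (halts_playProgram
    { r with
      K := min r.k r.N
      E := min r.k r.N ^ 3
      W := W
      tmp := t
      len := L
      Lr := L
      i := i
      j := j
      base := b
      Q₁ := LearnerState.accumulate r.N W r.u r.G₁ r.Q₁
      Q₀ := LearnerState.accumulate r.N W r.u r.G₀ r.Q₀ } hN rfl) ?_ le_rfl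
  rintro _ ⟨i, j, l, b, w, x, y, z, a, c, rfl⟩
  refine ⟨_, rfl, rfl, rfl, rfl, rfl, rfl, rfl, fun l hl => by
    dsimp only; exact overwrite_of_lt hl _ _, ?_⟩
  intro l hl i hi
  simp only [overwriteNat]
  rw [if_pos (index_lt hl hi), index_div hi, index_mod hi]

/-! ### The interaction over all rounds -/

theorem startMemory_eq (N k : ℕ) (ε : ℝ) :
    ∃ r : Vars, startMemory N k ε = r.mem ∧ r.N = N ∧ r.k = k ∧ r.eps = ε ∧ r.u = 0 ∧
      r.state = LearnerState.initial := by
  let r : Vars :=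
    { N := N, k := k, len := 0, bits := 0, K := 0, E := 0, W := 0, tmp := 0, i := 0, j := 0, l := 0,
      base := 0, row := 0, eps := ε, u := 0, wt := 0, Lr := 0, Q₁ := 0, Q₀ := 0, G₁ := 0, G₀ := 0,
      s := 0, lit := 0, S := 0, num := 0, den := 0, phi := 0 }
  refine ⟨r, ?_, rfl, rfl, rfl, rfl, rfl⟩
  refine Memory.ext (funext fun a => funext fun q => ?_) (funext fun a => funext fun q => ?_)
  · by_cases ha : a = 0
    · subst ha
      simp [startMemory, Vars.mem, r]
    · have h : (startMemory N k ε).nat a q = 0 := by simp [startMemory, ha]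
      rw [h]
      simp only [Vars.mem]
      split <;> first | exact absurd rfl ha | simp [r, cell]
  · by_cases ha : a = 0
    · subst ha
      simp [startMemory, Vars.mem, r, cell]
    · have h : (startMemory N k ε).real a q = 0 := by simp [startMemory, ha]
      rw [h]
      simp only [Vars.mem]
      split <;> first | exact absurd rfl ha | simp [r, cell]

theorem receive_mem {N : ℕ} (r : Vars) (u : Fin N → ℝ) :
    r.mem.receive u = { r with u := fun i => if h : i < N then u ⟨i, h⟩ else r.u i }.mem := by
  refine Memory.ext rfl (funext fun a => funext fun q => ?_)
  by_cases ha : a = 1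
  · subst ha
    simp [Memory.receive, Vars.mem]
  · simp only [Memory.receive, ha, false_and, dite_false, Vars.mem]
    split <;> first | rfl | exact absurd rfl ha

theorem outputs_mem {N W L : ℕ} (hL : 0 < L) {r : Vars} {s : ℕ → ℝ} (hlen : r.len = L)
    (hwt : ∀ l < L, r.wt l = 1 / L) (hbits : ∀ l < L, ∀ i < N, r.bits (l * N + i) =
      if played N W r.Q₁ r.Q₀ s l i then 1 else 0) :
    Outputs r.mem (strategy N W L r.Q₁ r.Q₀ s) := by
  have hout : r.mem.outLength = L := hlen
  refine ⟨strategy_mem_stdSimplex W hL _ _ _, fun l hl => ⟨?_, fun i => ?_⟩, fun x => ?_⟩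
  · rw [hout] at hl
    refine le_of_le_of_eq ?_ (hwt l hl).symm
    positivity
  · rw [hout] at hl
    refine (hbits l hl i i.isLt).le.trans ?_
    split_ifs <;> omega
  · rw [hout, strategy]
    refine Finset.sum_congr (Finset.filter_congr fun l hl => ?_) fun l hl => ?_
    · rw [Finset.mem_range] at hl
      have : (fun i : Fin N => decide (r.mem.outBit N l i = 1)) =
          restrict N (played N W r.Q₁ r.Q₀ s l) := by
        funext i
        change decide (r.bits (l * N + i) = 1) = _
        rw [hbits l hl i i.isLt, restrict]
        cases played N W r.Q₁ r.Q₀ s l i <;> simp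
      rw [this]
    · exact (hwt l (Finset.mem_range.mp (Finset.mem_of_mem_filter l hl))).symm

/-- The utilities that are known before round `t`. -/
def revealed {N : ℕ} (u : ℕ → Fin N → ℝ) : ℕ → ℕ → ℝ
  | 0 => 0
  | t + 1 => fun i => if h : i < N then u t ⟨i, h⟩ else 0

theorem revealed_of_le {N : ℕ} (u : ℕ → Fin N → ℝ) (t : ℕ) {i : ℕ} (hi : N ≤ i) :
    revealed u t i = 0 := by
  cases t with
  | zero => rfl
  | succ t => exact dif_neg (not_lt.mpr hi)

/-- The learner. -/
def learner : Learner := ⟨nextProgram, .nop⟩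

open LearnerState in
theorem plays_learner {N k W L : ℕ} {ε : ℝ} (hN : 0 < N) (hε : 0 < ε)
    (hW : (2 * N + 1) ^ min k N ^ 3 = W) (hL : ⌈8 / ε⌉₊ = L) (u : ℕ → Fin N → ℝ) :
    ∃ time : ℕ → ℕ, Plays learner N k ε u (fun t => strategy N W L
      (after N W L (revealed u) (t + 1)).weight₁ (after N W L (revealed u) (t + 1)).weight₀
      (after N W L (revealed u) t).disc) time ∧
      ∀ t, time t ≤ ((min k N * 100 + min k N ^ 3 * (N * 100 + 100) + 100) +
        ((L * 30 + 20) + ((N * (W * 200 + 50) + 20) +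
      (L * ((N * 100 + 20) + (W * (N * 100 + 50) + 20) +
        (N * (W * 200 + 100) + 20) + 50) + 20)))) + (N + 1) * L + N + 1 := by
  have hL0 : 0 < L := by
    rw [← hL]
    exact Nat.ceil_pos.mpr (by positivity)
  let Inv : ℕ → Memory → Prop := fun t σ => ∃ r : Vars, σ = r.mem ∧ r.N = N ∧ r.k = k ∧
    r.eps = ε ∧ r.u = revealed u t ∧ r.state = after N W L (revealed u) t
  have step : ∀ t σ, Inv t σ → ∃ m τ, m ≤ ((min k N * 100 + min k N ^ 3 * (N * 100 + 100) + 100) +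
        ((L * 30 + 20) + ((N * (W * 200 + 50) + 20) +
      (L * ((N * 100 + 20) + (W * (N * 100 + 50) + 20) +
        (N * (W * 200 + 100) + 20) + 50) + 20)))) ∧ Exec nextProgram σ m τ ∧
      Outputs τ (strategy N W L (after N W L (revealed u) (t + 1)).weight₁
        (after N W L (revealed u) (t + 1)).weight₀ (after N W L (revealed u) t).disc) ∧
      τ.outLength = L ∧ Inv (t + 1) (τ.receive (u t)) := by
    rintro t _ ⟨r, rfl, rfl, rfl, rfl, hu, hs⟩
    obtain ⟨m, _, hm, he, r', rfl, h1, h2, h3, h4, h5, h6, h7, h8⟩ :=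
      halts_nextProgram r hN hε hW hL
    have hs' : r'.state = after r.N W L (revealed u) (t + 1) := by
      rw [h6, hu, hs]
      rfl
    refine ⟨m, _, hm, he, ?_, h5, ?_⟩
    · rw [← hs', ← hs]
      exact outputs_mem hL0 h5 h7 h8
    · refine ⟨_, receive_mem r' (u t), h1, h2, h3, ?_, hs'⟩
      funext i
      change (if h : i < r.N then u t ⟨i, h⟩ else r'.u i) = if h : i < r.N then u t ⟨i, h⟩ else 0
      rw [h4, hu]
      by_cases hi : i < r.N
      · rw [dif_pos hi, dif_pos hi]
      · rw [dif_neg hi, dif_neg hi, revealed_of_le u t (not_lt.mp hi)]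
  choose! m τ hm he ho hl hI using step
  -- One step has been chosen for every memory satisfying the invariant; the actual run iterates it
  -- from the initial memory.
  let σ : ℕ → Memory := fun t =>
    Nat.rec (startMemory N k ε) (fun t s => (τ t s).receive (u t)) t
  have hσ : ∀ t, Inv t (σ t) := by
    intro t
    induction t with
    | zero => exact startMemory_eq N k ε
    | succ t ih => exact hI t _ ih
  refine ⟨fun t => m t (σ t) + (N + 1) * (τ t (σ t)).outLength + N + 1,
    ⟨σ, fun t => τ t (σ t), fun t => m t (σ t), fun _ => 1, rfl, fun t =>
      ⟨he t _ (hσ t), ho t _ (hσ t), .nop _, rfl⟩⟩, fun t => ?_⟩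
  dsimp only
  rw [hl t _ (hσ t)]
  have := hm t _ (hσ t)
  omega

/-! ## Size estimates -/

/-- For `N ≥ 2` one has `2 N + 1 ≤ N ^ 3`. For `N = 1` the exponent is capped at `1` and the count
is `3`, whence the factor. -/
theorem count_le {N k : ℕ} (hN : 1 ≤ N) (hk : 1 ≤ k) :
    (2 * N + 1) ^ min k N ^ 3 ≤ 3 * N ^ (3 * k ^ 3) := by
  rcases hN.eq_or_lt with rfl | hN
  · simp [hk]
  · have h1 : 2 * N + 1 ≤ N ^ 3 := by nlinarith [Nat.mul_le_mul hN hN]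
    calc (2 * N + 1) ^ min k N ^ 3 ≤ (N ^ 3) ^ min k N ^ 3 := Nat.pow_le_pow_left h1 _
      _ ≤ (N ^ 3) ^ k ^ 3 := Nat.pow_le_pow_right (by positivity)
          (Nat.pow_le_pow_left (min_le_left _ _) _)
      _ = N ^ (3 * k ^ 3) := (pow_mul _ _ _).symm
      _ ≤ _ := Nat.le_mul_of_pos_left _ (by norm_num)

/-- The main cost is, for each of `L` points, work of order `N * W`, and `N` is at most `W`. -/
theorem steps_le {N K W L : ℕ} (hL : 1 ≤ L) (hN : 2 * N + 1 ≤ W) (hK : K ≤ W) (hK3 : K ^ 3 ≤ W) :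
    ((K * 100 + K ^ 3 * (N * 100 + 100) + 100) + ((L * 30 + 20) + ((N * (W * 200 + 50) + 20) +
      (L * ((N * 100 + 20) + (W * (N * 100 + 50) + 20) +
        (N * (W * 200 + 100) + 20) + 50) + 20)))) + (N + 1) * L + N + 1 ≤ 2000 * (L * W ^ 2) := by
  have hW : 1 ≤ W := by omega
  have hWW : W ≤ W ^ 2 := Nat.le_self_pow two_ne_zero W
  have h1 : K ^ 3 * (N * 100 + 100) ≤ 100 * W ^ 2 := by
    calc K ^ 3 * (N * 100 + 100) ≤ W * (100 * W) := Nat.mul_le_mul hK3 (by omega)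
      _ = _ := by ring
  have h2 : N * (W * 200 + 50) ≤ 250 * W ^ 2 := by
    calc N * (W * 200 + 50) ≤ W * (250 * W) := Nat.mul_le_mul (by omega) (by omega)
      _ = _ := by ring
  have h3 : (N * 100 + 20) + (W * (N * 100 + 50) + 20) + (N * (W * 200 + 100) + 20) + 50 ≤
      760 * W ^ 2 := by
    have a : W * (N * 100 + 50) ≤ 150 * W ^ 2 := by
      calc W * (N * 100 + 50) ≤ W * (150 * W) := Nat.mul_le_mul le_rfl (by omega)
        _ = _ := by ring
    have b : N * (W * 200 + 100) ≤ 300 * W ^ 2 := by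
      calc N * (W * 200 + 100) ≤ W * (300 * W) := Nat.mul_le_mul (by omega) (by omega)
        _ = _ := by ring
    omega
  have h4 : L * ((N * 100 + 20) + (W * (N * 100 + 50) + 20) + (N * (W * 200 + 100) + 20) + 50) ≤
      760 * (L * W ^ 2) :=
    (Nat.mul_le_mul le_rfl h3).trans (le_of_eq (by ring))
  have h5 : (N + 1) * L ≤ L * W ^ 2 := by
    rw [mul_comm]
    exact Nat.mul_le_mul le_rfl (by omega)
  have h6 : W ^ 2 ≤ L * W ^ 2 := Nat.le_mul_of_pos_left _ hL
  have h7 : L ≤ L * W ^ 2 := Nat.le_mul_of_pos_right _ (by positivity)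
  omega

end LowDegreeRegret

end

/-! ### Choice of the constant -/

theorem mainTheorem6 :
    ∃ (A : LowDegreeRegret.Learner) (C : ℕ),
      ∀ (N k : ℕ) (ε : ℝ), 1 ≤ N → 1 ≤ k → 0 < ε → ε ≤ 2 →
        ∀ u : ℕ → Fin N → ℝ, (∀ t, u t ∈ LowDegreeRegret.utilities N) →
          ∃ (π : ℕ → LowDegreeRegret.Cube N → ℝ) (time : ℕ → ℕ),
            LowDegreeRegret.Plays A N k ε u π time ∧
            (∀ t, (time t : ℝ) ≤ C * (N : ℝ) ^ (C * k ^ 3) / ε) ∧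
            ∀ T : ℕ, C * (N : ℝ) ^ (C * k ^ 3) / ε ^ 2 ≤ T →
              LowDegreeRegret.avgRegret (LowDegreeRegret.polyDeviations N k) u π T ≤ ε := by
  -- With `W ≤ 3 * N ^ (3 * k ^ 3)` and `L ≤ 10 / ε`, the time bound has coefficient `2000 * 10 * 3
  -- ^ 2 = 180000` and exponent `6 * k ^ 3`. The horizon needs only `8 * 3 ^ 5 = 1944` and `15 * k ^
  -- 3`.
  refine ⟨LowDegreeRegret.learner, 180000, fun N k ε hN hk hε hε2 u hu => ?_⟩
  have hN' : (1 : ℝ) ≤ N := by exact_mod_cast hN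
  obtain ⟨W, hW⟩ : ∃ W, (2 * N + 1) ^ min k N ^ 3 = W := ⟨_, rfl⟩
  obtain ⟨L, hL⟩ : ∃ L, ⌈8 / ε⌉₊ = L := ⟨_, rfl⟩
  have hK : 1 ≤ min k N := le_min hk hN
  have hNW : 2 * N + 1 ≤ W := by
    rw [← hW]
    exact Nat.le_self_pow (pow_ne_zero 3 (by omega)) _
  have hK3 : min k N ^ 3 ≤ W := by
    rw [← hW]
    exact (Nat.lt_pow_self (by omega)).le
  have hKW : min k N ≤ W := (Nat.le_self_pow three_ne_zero _).trans hK3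
  have hWle : (W : ℝ) ≤ 3 * (N : ℝ) ^ (3 * k ^ 3) := by
    rw [← hW]
    exact_mod_cast LowDegreeRegret.count_le hN hk
  have hLle : (L : ℝ) ≤ 10 / ε := by
    have h1 := Nat.ceil_lt_add_one (show 0 ≤ 8 / ε by positivity)
    rw [hL] at h1
    -- The hypothesis `ε ≤ 2` absorbs the rounding up of `8 / ε` into `10 / ε`.
    have h2 : 1 ≤ 2 / ε := by rwa [le_div_iff₀ hε, one_mul]
    have h3 : 8 / ε + 2 / ε = 10 / ε := by ring
    linarith
  have hL1 : 1 ≤ L := by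
    rw [← hL]
    exact Nat.ceil_pos.mpr (by positivity)
  obtain ⟨time, hplays, htime⟩ := LowDegreeRegret.plays_learner hN hε hW hL u
  refine ⟨_, time, hplays, fun t => ?_, fun T hT => ?_⟩
  · have h1 : (time t : ℝ) ≤ 2000 * (L * W ^ 2) := by
      exact_mod_cast (htime t).trans (LowDegreeRegret.steps_le hL1 hNW hKW hK3)
    refine h1.trans ?_
    calc 2000 * ((L : ℝ) * W ^ 2) ≤ 2000 * (10 / ε * (3 * (N : ℝ) ^ (3 * k ^ 3)) ^ 2) := by gcongr
      _ = 180000 * (N : ℝ) ^ (6 * k ^ 3) / ε := by ring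
      _ ≤ ((180000 : ℕ) : ℝ) * (N : ℝ) ^ (180000 * k ^ 3) / ε := by
        push_cast
        gcongr
        norm_num
  · refine LowDegreeRegret.avgRegret_le hε ?_ hu rfl (fun t i => ?_) hW.symm (by omega) ?_
    · rw [← hL]
      exact Nat.le_ceil _
    · simp [LowDegreeRegret.revealed]
    · refine le_trans ?_ hT
      calc 8 * (W : ℝ) ^ 5 / ε ^ 2 ≤ 8 * (3 * (N : ℝ) ^ (3 * k ^ 3)) ^ 5 / ε ^ 2 := by gcongr
        _ = 1944 * (N : ℝ) ^ (15 * k ^ 3) / ε ^ 2 := by ring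
        _ ≤ ((180000 : ℕ) : ℝ) * (N : ℝ) ^ (180000 * k ^ 3) / ε ^ 2 := by
          push_cast
          gcongr
          · norm_num
          · norm_num
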